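/- **Theorem 6 (Joint outage probability of communication and control under MRT).** *System.* A base station with $M\ge 2$ antennas serves a communication user (CU) with channel $\mathbf h_U\in\mathbb C^M$ and a control device (CD) with channel $\mathbf h_D\in\mathbb C^M$. The channels are independent, $\mathbf h_D\sim\mathcal{CN}(\mathbf 0,\beta_D\mathbf I_M)$ and $\mathbf h_U\sim\mathcal{CN}(\mathbf 0,\beta_U\mathbf I_M)$ with $\beta_D,\beta_U>0$. Let $P_{\rm up},P_{\rm dn},B_{\rm up},B_{\rm dn},T,N_0,Q_U>0$ (transmit powers, bandwidths, sampling period, noise density, payload), $\sigma_{\rm up}^2=N_0B_{\rm up}$, $\sigma_{\rm dn}^2=N_0B_{\rm dn}$, $\alpha_{\rm up}=B_{\rm up}T$, $\alpha_{\rm dn}=B_{\rm dn}T$. Under MRT the downlink beams are $\mathbf w_D=\sqrt{p_D}\,\mathbf h_D/\|\mathbf h_D\|$ and $\mathbf w_U=\sqrt{p_U}\,\mathbf h_U/\|\mathbf h_U\|$ with $p_D,p_U\ge 0$, $p_D+p_U=P_{\rm dn}$. Put $$\mathrm{SINR}_U=\frac{|\mathbf h_U^H\mathbf w_U|^2}{|\mathbf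 h_U^H\mathbf w_D|^2+\sigma_{\rm dn}^2},\quad \mathrm{SINR}_D=\frac{|\mathbf h_D^H\mathbf w_D|^2}{|\mathbf h_D^H\mathbf w_U|^2+\sigma_{\rm dn}^2},\quad S_\alpha=\Bigl(1+\frac{P_{\rm up}\|\mathbf h_D\|^2}{\sigma_{\rm up}^2}\Bigr)^{\alpha_{\rm up}},\quad \Gamma_\alpha=(1+\mathrm{SINR}_D)^{\alpha_{\rm dn}}.$$ The communication delay is $\tau_U=Q_U/\bigl(B_{\rm dn}\log_2(1+\mathrm{SINR}_U)\bigr)$ ($=\infty$ if $\mathrm{SINR}_U=0$). *Control loop.* For fixed channels and a fixed power split, the state evolves as $x_{n+1}=a x_n+b\hat d_n+w_n$ with $a,b\in\mathbb C$, $|a|>1$, $b\ne 0$, i.i.d. $w_n\sim\mathcal{CN}(0,\sigma_w^2)$, $\sigma_w^2>0$, and $x_0\sim\mathcal{CN}(0,V_0)$, $V_0\ge 0$. Here $\hat x_n$ is the Gaussian rate–distortion-optimal reconstruction of $x_n$ with distortion $\mathbb E|x_n|^2/S_\alpha$, $d_n=-(a/b)\hat x_n$, and $\hat d_n$ is the Gaussian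 rate–distortion-optimal reconstruction of $d_n$ with distortion $\mathbb E|d_n|^2/\Gamma_\alpha$; the optimal reconstruction of $X$ with distortion $\mathbb E|X|^2/q$, $q\ge 1$, is $(1-\tfrac1q)X+\sqrt{\tfrac{\mathbb E|X|^2}{q}(1-\tfrac1q)}\,Z$ with $Z\sim\mathcal{CN}(0,1)$. All the variables $Z$, all $w_n$ and $x_0$ are independent. Let $V_\infty=\lim_{n\to\infty}\mathbb E|x_n|^2$ ($=\infty$ if the variances diverge). *Outage.* Let $\tau_{\rm req}>0$ and $V_{\rm req}>\sigma_w^2$. The outage probability $P_{\rm out}^{\rm JDCC,MRT}$ is $1$ minus the probability of the event that some power split $p_D\in[0,P_{\rm dn}]$, $p_U=P_{\rm dn}-p_D$, gives both $\tau_U\le\tau_{\rm req}$ and $V_\infty\le V_{\rm req}$. *Claim.* $$P_{\rm out}^{\rm JDCC,MRT}=1-\int_{\eta_V}^{\infty}\!\int_0^{r_{\max}(x)} f_G(x)\,f_\rho(r)\,\mathbf 1\bigl(x>\xi(x,r)\bigr)\bigl[1-F_G(\psi(x,r))\bigr]\,dr\,dx,$$ where the double integral converges absolutely, $f_\rho(r)=(M-1)(1-r)^{M-2}$,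 $f_G(x)=\frac{x^{M-1}e^{-x}}{(M-1)!}$, $$F_G(x)=\frac{1}{\Gamma(M)}\int_0^x t^{M-1}e^{-t}\,dt=1-e^{-x}\sum_{k=0}^{M-1}\frac{x^k}{k!}\qquad(x\ge 0),$$ and, with $\bar\gamma_{\rm up}=\frac{P_{\rm up}\beta_D}{\sigma_{\rm up}^2}$, $\bar\gamma_d=\frac{P_{\rm dn}\beta_D}{\sigma_{\rm dn}^2}$, $\gamma_U=2^{Q_U/(B_{\rm dn}\tau_{\rm req})}-1$, $\eta_U=\frac{\gamma_U\sigma_{\rm dn}^2}{P_{\rm dn}\beta_U}$, $S(x)=(1+\bar\gamma_{\rm up}x)^{\alpha_{\rm up}}$, $$\eta_V=\frac1{\bar\gamma_{\rm up}}\Bigl[\Bigl(\frac{|a|^2V_{\rm req}}{V_{\rm req}-\sigma_w^2}\Bigr)^{1/\alpha_{\rm up}}-1\Bigr],\qquad \gamma_D(x)=\Bigl(\frac{|a|^2V_{\rm req}(S(x)-1)}{S(x)(V_{\rm req}-\sigma_w^2)-|a|^2V_{\rm req}}\Bigr)^{1/\alpha_{\rm dn}}-1,\qquad \eta_f(x)=\frac{\gamma_D(x)}{\bar\gamma_d},$$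 $$r_{\max}(x)=\min\Bigl(1,\frac1{\sqrt{\gamma_U\gamma_D(x)}}\Bigr),\qquad \xi(x,r)=\frac{\eta_f(x)(1+\gamma_U r)}{1-\gamma_U\gamma_D(x)r^2},$$ $$\psi(x,r)=\frac{\eta_U x(1+\gamma_D(x)r)}{x\bigl(1-\gamma_U\gamma_D(x)r^2\bigr)-\eta_f(x)(1+\gamma_U r)}.$$ -/

import Mathlib

open MeasureTheory ProbabilityTheory Filter Topology
open scoped ENNReal

namespace JDCC

noncomputable section

/-! ### Complex Gaussian laws -/

/-- The circularly symmetric complex Gaussian law `CN(0, v)` (`v ≥ 0`): independent real and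
imaginary parts, each centred Gaussian with variance `v / 2`. -/
def complexGaussian (v : ℝ) : Measure ℂ :=
  ((gaussianReal 0 (v / 2).toNNReal).prod (gaussianReal 0 (v / 2).toNNReal)).map
    (fun p : ℝ × ℝ => (⟨p.1, p.2⟩ : ℂ))

/-- The law `CN(0, v I_M)` of a vector with i.i.d. `CN(0, v)` entries. -/
def complexGaussianVector (M : ℕ) (v : ℝ) : Measure (EuclideanSpace ℂ (Fin M)) :=
  (Measure.pi (fun _ : Fin M => complexGaussian v)).map (WithLp.toLp 2)

/-! ### System parameters -/

/-- The deterministic parameters of the system. -/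
structure System where
  /-- plant coefficient -/
  a : ℂ
  /-- input coefficient -/
  b : ℂ
  /-- variance of the process noise -/
  varW : ℝ
  /-- uplink transmit power -/
  Pup : ℝ
  /-- downlink power budget -/
  Pdn : ℝ
  /-- uplink bandwidth -/
  Bup : ℝ
  /-- downlink bandwidth -/
  Bdn : ℝ
  /-- sampling period of the control process -/
  Ts : ℝ
  /-- noise power spectral density -/
  N0 : ℝ
  /-- large-scale coefficient of the control device (CD) -/
  betaD : ℝ
  /-- large-scale coefficient of the communication user (CU) -/
  betaU : ℝ
  /-- communication payload in bits -/
  QU : ℝ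
  /-- largest tolerable communication delay -/
  tauReq : ℝ
  /-- largest tolerable steady-state control variance -/
  Vreq : ℝ

namespace System

variable (s : System)

/-- Uplink noise power. -/
def varUp : ℝ := s.N0 * s.Bup

/-- Downlink noise power. -/
def varDn : ℝ := s.N0 * s.Bdn

/-- Uplink time-bandwidth product. -/
def alphaUp : ℝ := s.Bup * s.Ts

/-- Downlink time-bandwidth product. -/
def alphaDn : ℝ := s.Bdn * s.Ts

end System

/-! ### Beamforming, SNR and SINR -/

/-- Maximum-ratio transmission along `h` with power `p`. -/
def mrtBeam {M : ℕ} (p : ℝ) (h : EuclideanSpace ℂ (Fin M)) : EuclideanSpace ℂ (Fin M) :=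
  ((Real.sqrt p / ‖h‖ : ℝ) : ℂ) • h

/-- The SINR `|hᴴ w|² / (|hᴴ w'|² + σ²)` of a receiver with channel `h`, own beam `w`,
interfering beam `w'` and noise power `σ²`. -/
def sinr {M : ℕ} (h w w' : EuclideanSpace ℂ (Fin M)) (noise : ℝ) : ℝ :=
  ‖inner ℂ h w‖ ^ 2 / (‖inner ℂ h w'‖ ^ 2 + noise)

/-- Uplink SNR after maximum-ratio combining. -/
def snrUp (s : System) {M : ℕ} (hD : EuclideanSpace ℂ (Fin M)) : ℝ :=
  s.Pup * ‖hD‖ ^ 2 / s.varUp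

/-! ### Communication delay -/

/-- The transmission delay `Q_U / (B_dn log₂ (1 + Γ))` at communication SINR `Γ`;
it is `∞` when the rate is `0`. -/
def delay (s : System) (Γ : ℝ) : ℝ≥0∞ :=
  ENNReal.ofReal s.QU / ENNReal.ofReal (s.Bdn * Real.logb 2 (1 + Γ))

/-! ### The control loop -/

/-- The primitive random variables of the control loop: the initial state, the process noise,
and the randomness of the uplink and downlink reconstructions. -/
inductive NoiseIdx where
  | init : NoiseIdx
  | process : ℕ → NoiseIdx
  | up : ℕ → NoiseIdx
  | down : ℕ → NoiseIdx

/-- All primitive variables are independent; the initial state is `CN(0, V₀)`, the process noise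
is `CN(0, σ_w²)` and the reconstruction noises are `CN(0, 1)`. -/
structure IsControlNoise (s : System) (V0 : ℝ) {Ω' : Type*} [MeasurableSpace Ω']
    (ν : Measure Ω') (ζ : NoiseIdx → Ω' → ℂ) : Prop where
  indep : iIndepFun ζ ν
  init_law : HasLaw (ζ .init) (complexGaussian V0) ν
  process_law : ∀ n, HasLaw (ζ (.process n)) (complexGaussian s.varW) ν
  up_law : ∀ n, HasLaw (ζ (.up n)) (complexGaussian 1) ν
  down_law : ∀ n, HasLaw (ζ (.down n)) (complexGaussian 1) ν

/-- Second moment `E|X|²`. -/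
def meanSq {Ω' : Type*} [MeasurableSpace Ω'] (ν : Measure Ω') (X : Ω' → ℂ) : ℝ :=
  ∫ ω, ‖X ω‖ ^ 2 ∂ν

/-- Gaussian rate-distortion-optimal reconstruction of a centred complex Gaussian `X` with
variance `V = E|X|²` from `log₂ q` bits, i.e. with distortion `D = V / q`, driven by `Z ~ CN(0,1)`
independent of `X`:
`X̂ = (1 - 1/q) X + √(D (1 - 1/q)) Z`.
For `q ≥ 1` this is the test channel for which `X̂ ~ CN(0, V - D)` and `X - X̂ ~ CN(0, D)` are
independent. -/
def reconstruct {Ω' : Type*} [MeasurableSpace Ω'] (ν : Measure Ω') (q : ℝ) (X Z : Ω' → ℂ) :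
    Ω' → ℂ :=
  fun ω => ((1 - 1 / q : ℝ) : ℂ) * X ω
    + (Real.sqrt (meanSq ν X / q * (1 - 1 / q)) : ℂ) * Z ω

/-- The closed-loop state process at uplink quality `S = (1 + SNR_D^up)^α_up` and downlink quality
`Γ = (1 + SINR_D^dn)^α_dn`. In interval `n` the state `xₙ` is reconstructed at the base station as
`x̂ₙ`, the command `dₙ = -(a/b) x̂ₙ` is reconstructed at the device as `d̂ₙ`, and
`xₙ₊₁ = a xₙ + b d̂ₙ + wₙ`. -/
def state (s : System) {Ω' : Type*} [MeasurableSpace Ω'] (ν : Measure Ω')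
    (ζ : NoiseIdx → Ω' → ℂ) (S Γ : ℝ) : ℕ → Ω' → ℂ
  | 0 => ζ .init
  | n + 1 =>
    let x := state s ν ζ S Γ n
    let xhat := reconstruct ν S x (ζ (.up n))
    let d : Ω' → ℂ := fun ω => -(s.a / s.b) * xhat ω
    let dhat := reconstruct ν Γ d (ζ (.down n))
    fun ω => s.a * x ω + s.b * dhat ω + ζ (.process n) ω

/-- The control requirement `V_∞ ≤ V_req`: the state variances `Vₙ = E|xₙ|²` converge, and their
limit `V_∞` is at most `V_req`. -/
def ControlOK (s : System) {Ω' : Type*} [MeasurableSpace Ω'] (ν : Measure Ω')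
    (ζ : NoiseIdx → Ω' → ℂ) (S Γ : ℝ) : Prop :=
  ∃ V : ℝ, Tendsto (fun n => meanSq ν (state s ν ζ S Γ n)) atTop (𝓝 V) ∧ V ≤ s.Vreq

/-! ### Joint outage under MRT -/

/-- Success for the channel realization `(hD, hU)`: some split `p_D + p_U = P_dn` of the power
between the two MRT beams meets both the delay and the control requirement. -/
def MRTSuccess (s : System) {Ω' : Type*} [MeasurableSpace Ω'] (ν : Measure Ω')
    (ζ : NoiseIdx → Ω' → ℂ) {M : ℕ} (hD hU : EuclideanSpace ℂ (Fin M)) : Prop :=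
  ∃ pD ∈ Set.Icc 0 s.Pdn,
    let wD := mrtBeam pD hD
    let wU := mrtBeam (s.Pdn - pD) hU
    delay s (sinr hU wU wD s.varDn) ≤ ENNReal.ofReal s.tauReq ∧
    ControlOK s ν ζ ((1 + snrUp s hD) ^ s.alphaUp)
      ((1 + sinr hD wD wU s.varDn) ^ s.alphaDn)

/-- The joint outage probability under MRT. -/
def outageMRT (s : System) {Ω' : Type*} [MeasurableSpace Ω'] (ν : Measure Ω')
    (ζ : NoiseIdx → Ω' → ℂ) {Ω : Type*} [MeasurableSpace Ω] (P : Measure Ω) {M : ℕ}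
    (hD hU : Ω → EuclideanSpace ℂ (Fin M)) : ℝ :=
  1 - P.real {ω | MRTSuccess s ν ζ (hD ω) (hU ω)}

/-! ### The quantities in the closed formula -/

/-- Density of `Gamma(M, 1)` on `(0, ∞)`. -/
def fG (M : ℕ) (x : ℝ) : ℝ := x ^ (M - 1) * Real.exp (-x) / (M - 1).factorial

/-- Distribution function `γ(M, x) / Γ(M)` of `Gamma(M, 1)` for `x ≥ 0`. -/
def FG (M : ℕ) (x : ℝ) : ℝ :=
  (∫ t in (0 : ℝ)..x, t ^ (M - 1) * Real.exp (-t)) / Real.Gamma M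

/-- Density of `Beta(1, M - 1)` on `[0, 1]`, for `M ≥ 2`. -/
def fRho (M : ℕ) (r : ℝ) : ℝ := ((M : ℝ) - 1) * (1 - r) ^ (M - 2)

namespace System

variable (s : System)

/-- `γ̄_up`. -/
def gbarUp : ℝ := s.Pup * s.betaD / s.varUp

/-- `γ̄_d`. -/
def gbarD : ℝ := s.Pdn * s.betaD / s.varDn

/-- `γ_U^req`. -/
def gammaUreq : ℝ := (2 : ℝ) ^ (s.QU / (s.Bdn * s.tauReq)) - 1

/-- `η_U`. -/
def etaU : ℝ := s.gammaUreq * s.varDn / (s.Pdn * s.betaU)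

/-- `η_V`. -/
def etaV : ℝ :=
  1 / s.gbarUp * ((‖s.a‖ ^ 2 * s.Vreq / (s.Vreq - s.varW)) ^ (1 / s.alphaUp) - 1)

/-- `S_α` as a function of the normalized gain `x`. -/
def Salpha (x : ℝ) : ℝ := (1 + s.gbarUp * x) ^ s.alphaUp

/-- `γ_D^req(x)`. -/
def gammaDreq (x : ℝ) : ℝ :=
  (‖s.a‖ ^ 2 * s.Vreq * (s.Salpha x - 1) /
    (s.Salpha x * (s.Vreq - s.varW) - ‖s.a‖ ^ 2 * s.Vreq)) ^ (1 / s.alphaDn) - 1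

/-- `η_f(x)`. -/
def etaf (x : ℝ) : ℝ := s.gammaDreq x / s.gbarD

/-- `r_max(x)`. -/
def rmax (x : ℝ) : ℝ := min 1 (1 / Real.sqrt (s.gammaUreq * s.gammaDreq x))

/-- `ξ(x, r)`. -/
def xi (x r : ℝ) : ℝ :=
  s.etaf x * (1 + s.gammaUreq * r) / (1 - s.gammaUreq * s.gammaDreq x * r ^ 2)

/-- `ψ(x, r)`. -/
def psi (x r : ℝ) : ℝ :=
  s.etaU * x * (1 + s.gammaDreq x * r) /
    (x * (1 - s.gammaUreq * s.gammaDreq x * r ^ 2) - s.etaf x * (1 + s.gammaUreq * r))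

/-- The integrand of the success probability. -/
def integrand (M : ℕ) (x r : ℝ) : ℝ :=
  fG M x * fRho M r * (if s.xi x r < x then 1 else 0) * (1 - FG M (s.psi x r))

end System

end

end JDCC

/-!
For a fixed pair of channels everything depends on three numbers: the gains `x = ‖h_D‖² / β_D` and
`y = ‖h_U‖² / β_U`, and `r`, the squared cosine of the angle between the channels.

*Control loop.* The reconstruction noises and the process noise of an interval are orthogonal to
the current state, so second moments add up and the variances satisfy
`Vₙ₊₁ = |a|² (1 - (1 - 1/S)(1 - 1/Γ)) Vₙ + σ_w²` (`meanSq_state_succ`). As `σ_w² > 0`, this affine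
recursion converges iff its slope is below `1`, and then to its fixed point. Solving
`V_∞ ≤ V_req` for `Γ` gives `x > η_V` and `SINR_D ≥ γ_D(x)`
(`System.Valid.controlOK_iff_gamma`). The delay requirement is `SINR_U ≥ γ_U` (`delay_le_iff`).

*Power split.* Under MRT both SINR requirements are linear in the power split. Each one prescribes a
least fraction of the power, and a split exists iff the two least fractions add up to at most `1`
(`exists_split_iff`). Solved for `y`, this reads `1 - γ_U γ_D(x) r² > 0`, `ξ(x, r) < x` and
`ψ(x, r) ≤ y` (`mrtSuccess_iff`).

*Channel law.* `CN(0, v I)` is invariant under unitary maps, so `h_D` may be rotated onto the first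
axis; then `r` is the share of the first entry in `‖h_U‖²`. The squared moduli of the entries are
independent exponentials, and the change of variables `(e, ρ) ↦ (e / (e + ρ), e + ρ)`
(`lintegral_erlang_ratio_sum`) shows that `r ~ Beta(1, M - 1)` and `y ~ Gamma(M, 1)` are
independent of each other and of `x ~ Gamma(M, 1)` (`lintegral_complexGaussianVector_angle`).

Integrating out `y` produces the factor `1 - F_G(ψ)` (`measure_feasibleChannels`). The integrand is
nonnegative off a null set and its integral is a probability, which also gives absolute convergence.
-/

namespace JDCC

/-! ### Second moments of the control loop -/

section Orthogonality

variable {Ω' : Type*} [MeasurableSpace Ω'] {ν : Measure Ω'}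

/-- Two complex random variables are orthogonal if `E[X̄ Y] = 0`. -/
def Orth (ν : Measure Ω') (X Y : Ω' → ℂ) : Prop :=
  ∫ ω, inner ℂ (X ω) (Y ω) ∂ν = 0

theorem integrable_inner {X Y : Ω' → ℂ} (hX : MemLp X 2 ν) (hY : MemLp Y 2 ν) :
    Integrable (fun ω => inner ℂ (X ω) (Y ω)) ν := by
  have h := hY.integrable_mul (hX.star)
  refine h.congr (ae_of_all _ fun ω => ?_)
  simp [RCLike.inner_apply]

theorem Orth.add_left {X Y Z : Ω' → ℂ} (hX : MemLp X 2 ν) (hY : MemLp Y 2 ν) (hZ : MemLp Z 2 ν)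
    (h₁ : Orth ν X Z) (h₂ : Orth ν Y Z) : Orth ν (fun ω => X ω + Y ω) Z := by
  unfold Orth at *
  simp only [inner_add_left]
  rw [integral_add (integrable_inner hX hZ) (integrable_inner hY hZ), h₁, h₂, add_zero]

theorem Orth.const_mul_left {X Y : Ω' → ℂ} (h : Orth ν X Y) (c : ℂ) :
    Orth ν (fun ω => c * X ω) Y := by
  unfold Orth at *
  have : ∀ ω, inner ℂ (c * X ω) (Y ω) = starRingEnd ℂ c * inner ℂ (X ω) (Y ω) := fun ω => by
    rw [← smul_eq_mul, inner_smul_left]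
  simp only [this]
  rw [integral_const_mul, h, mul_zero]

theorem Orth.const_mul_right {X Y : Ω' → ℂ} (h : Orth ν X Y) (c : ℂ) :
    Orth ν X (fun ω => c * Y ω) := by
  unfold Orth at *
  have : ∀ ω, inner ℂ (X ω) (c * Y ω) = c * inner ℂ (X ω) (Y ω) := fun ω => by
    rw [← smul_eq_mul, inner_smul_right]
  simp only [this]
  rw [integral_const_mul, h, mul_zero]

theorem meanSq_add {X Y : Ω' → ℂ} (hX : MemLp X 2 ν) (hY : MemLp Y 2 ν) (h : Orth ν X Y) :
    meanSq ν (fun ω => X ω + Y ω) = meanSq ν X + meanSq ν Y := by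
  unfold meanSq Orth at *
  have key : ∀ ω, ‖X ω + Y ω‖ ^ 2 =
      ‖X ω‖ ^ 2 + ‖Y ω‖ ^ 2 + 2 * RCLike.re (inner ℂ (X ω) (Y ω)) := fun ω => by
    rw [norm_add_sq (𝕜 := ℂ)]; ring
  have hX2 : Integrable (fun ω => ‖X ω‖ ^ 2) ν := (memLp_two_iff_integrable_sq_norm hX.1).1 hX
  have hY2 : Integrable (fun ω => ‖Y ω‖ ^ 2) ν := (memLp_two_iff_integrable_sq_norm hY.1).1 hY
  have hI := integrable_inner hX hY
  have hre : ∫ ω, RCLike.re (inner ℂ (X ω) (Y ω)) ∂ν = 0 := by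
    have := integral_re hI
    rw [this, h]; simp
  simp only [key]
  have hXY : Integrable (fun ω => ‖X ω‖ ^ 2 + ‖Y ω‖ ^ 2) ν := hX2.add hY2
  rw [integral_add hXY (hI.re.const_mul 2), integral_add hX2 hY2, integral_const_mul, hre]
  ring

theorem meanSq_const_mul (c : ℂ) (X : Ω' → ℂ) :
    meanSq ν (fun ω => c * X ω) = ‖c‖ ^ 2 * meanSq ν X := by
  unfold meanSq
  simp only [norm_mul, mul_pow]
  rw [integral_const_mul]

theorem meanSq_nonneg (X : Ω' → ℂ) : 0 ≤ meanSq ν X :=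
  integral_nonneg fun _ => by positivity

theorem Orth.of_indepFun {X Y : Ω' → ℂ} (hX : AEStronglyMeasurable X ν)
    (hY : AEStronglyMeasurable Y ν) (h : IndepFun X Y ν) (hY0 : ∫ ω, Y ω ∂ν = 0) :
    Orth ν X Y := by
  unfold Orth
  have h' : IndepFun Y (fun ω => starRingEnd ℂ (X ω)) ν :=
    h.symm.comp measurable_id (φ := id) (ψ := fun z => starRingEnd ℂ z)
      (Complex.continuous_conj.measurable)
  have := h'.integral_fun_mul_eq_mul_integral hY
    (Complex.continuous_conj.comp_aestronglyMeasurable hX)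
  simp only [RCLike.inner_apply]
  rw [this, hY0, zero_mul]

end Orthogonality

/-! ### Moments of the complex Gaussian law -/

theorem measurable_complexMk : Measurable (fun p : ℝ × ℝ => (⟨p.1, p.2⟩ : ℂ)) :=
  Complex.measurableEquivRealProd.symm.measurable

instance isProbabilityMeasure_complexGaussian (v : ℝ) :
    IsProbabilityMeasure (complexGaussian v) :=
  Measure.isProbabilityMeasure_map measurable_complexMk.aemeasurable

theorem memLp_complexGaussian (v : ℝ) : MemLp id 2 (complexGaussian v) := by
  unfold complexGaussian
  rw [memLp_map_measure_iff (by fun_prop) measurable_complexMk.aemeasurable]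
  set g := gaussianReal 0 (v / 2).toNNReal
  have h0 : MemLp (fun x : ℝ => (x : ℂ)) 2 g :=
    (memLp_id_gaussianReal' (μ := 0) (v := (v / 2).toNNReal) 2 (by simp)).ofReal
  have h1 : MemLp (fun p : ℝ × ℝ => (p.1 : ℂ)) 2 (g.prod g) := h0.comp_fst _
  have h2 : MemLp (fun p : ℝ × ℝ => (p.2 : ℂ)) 2 (g.prod g) := h0.comp_snd _
  refine (h1.add (h2.mul_const Complex.I)).ae_eq (ae_of_all _ fun p => ?_)
  simp [Complex.ext_iff]

theorem integral_complexGaussian (v : ℝ) : ∫ z, z ∂complexGaussian v = 0 := by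
  have hint : Integrable (fun z : ℂ => z) (complexGaussian v) :=
    (memLp_complexGaussian v).integrable (by norm_num)
  have hre : ∫ z : ℂ, z.re ∂complexGaussian v = 0 := by
    unfold complexGaussian
    rw [integral_map measurable_complexMk.aemeasurable (by fun_prop)]
    simp only
    rw [integral_fun_fst (μ := gaussianReal 0 (v / 2).toNNReal)
      (ν := gaussianReal 0 (v / 2).toNNReal) (f := fun x : ℝ => x)]
    simp
  have him : ∫ z : ℂ, z.im ∂complexGaussian v = 0 := by
    unfold complexGaussian
    rw [integral_map measurable_complexMk.aemeasurable (by fun_prop)]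
    simp only
    rw [integral_fun_snd (μ := gaussianReal 0 (v / 2).toNNReal)
      (ν := gaussianReal 0 (v / 2).toNNReal) (f := fun x : ℝ => x)]
    simp
  apply Complex.ext
  · have := integral_re hint
    simp only [RCLike.re_to_complex] at this
    rw [← this, hre]; rfl
  · have := integral_im hint
    simp only [RCLike.im_to_complex] at this
    rw [← this, him]; rfl

theorem integral_sq_gaussianReal (w : NNReal) : ∫ x, x ^ 2 ∂gaussianReal 0 w = w := by
  have := variance_id_gaussianReal (μ := 0) (v := w)
  rw [variance_of_integral_eq_zero aemeasurable_id (by simp)] at this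
  simpa using this

theorem integral_norm_sq_complexGaussian {v : ℝ} (hv : 0 ≤ v) :
    ∫ z, ‖z‖ ^ 2 ∂complexGaussian v = v := by
  unfold complexGaussian
  rw [integral_map measurable_complexMk.aemeasurable (by fun_prop)]
  set g := gaussianReal 0 (v / 2).toNNReal with hg
  have hsq : ∀ p : ℝ × ℝ, ‖(⟨p.1, p.2⟩ : ℂ)‖ ^ 2 = p.1 ^ 2 + p.2 ^ 2 := fun p => by
    rw [Complex.sq_norm, Complex.normSq_mk]; ring
  have h0 : Integrable (fun x : ℝ => x ^ 2) g :=
    (memLp_id_gaussianReal' (μ := 0) (v := (v / 2).toNNReal) 2 (by simp)).integrable_sq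
  simp only [hsq]
  rw [integral_add (h0.comp_fst g) (h0.comp_snd g),
    integral_fun_fst (μ := g) (ν := g) (f := fun x : ℝ => x ^ 2),
    integral_fun_snd (μ := g) (ν := g) (f := fun x : ℝ => x ^ 2), hg, integral_sq_gaussianReal,
    Real.coe_toNNReal _ (by positivity)]
  simp

section ControlLoop

variable {s : System} {V0 : ℝ} {Ω' : Type*} [MeasurableSpace Ω'] {ν : Measure Ω'}

theorem memLp_of_hasLaw {X : Ω' → ℂ} {v : ℝ} (h : HasLaw X (complexGaussian v) ν) :
    MemLp X 2 ν := by
  have := memLp_complexGaussian v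
  rw [← h.map_eq, memLp_map_measure_iff (by fun_prop) h.aemeasurable] at this
  exact this

theorem integral_of_hasLaw {X : Ω' → ℂ} {v : ℝ} (h : HasLaw X (complexGaussian v) ν) :
    ∫ ω, X ω ∂ν = 0 := by
  rw [h.integral_eq, integral_complexGaussian]

theorem meanSq_of_hasLaw {X : Ω' → ℂ} {v : ℝ} (hv : 0 ≤ v)
    (h : HasLaw X (complexGaussian v) ν) : meanSq ν X = v := by
  unfold meanSq
  have := h.integral_comp (f := fun z : ℂ => ‖z‖ ^ 2) (by fun_prop)
  rw [← integral_norm_sq_complexGaussian hv, ← this]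
  rfl

/-- Every primitive variable is `CN(0, v)` for some `v`. -/
theorem IsControlNoise.exists_law {ζ : NoiseIdx → Ω' → ℂ} (hζ : IsControlNoise s V0 ν ζ)
    (i : NoiseIdx) : ∃ v, HasLaw (ζ i) (complexGaussian v) ν := by
  cases i with
  | init => exact ⟨_, hζ.init_law⟩
  | process n => exact ⟨_, hζ.process_law n⟩
  | up n => exact ⟨_, hζ.up_law n⟩
  | down n => exact ⟨_, hζ.down_law n⟩

theorem IsControlNoise.memLp {ζ : NoiseIdx → Ω' → ℂ} (hζ : IsControlNoise s V0 ν ζ)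
    (i : NoiseIdx) : MemLp (ζ i) 2 ν :=
  memLp_of_hasLaw (hζ.exists_law i).choose_spec

theorem IsControlNoise.orth {ζ : NoiseIdx → Ω' → ℂ} (hζ : IsControlNoise s V0 ν ζ)
    {i j : NoiseIdx} (h : i ≠ j) : Orth ν (ζ i) (ζ j) :=
  Orth.of_indepFun (hζ.memLp i).1 (hζ.memLp j).1 (hζ.indep.indepFun h)
    (integral_of_hasLaw (hζ.exists_law j).choose_spec)

/-- `i` is a primitive variable that enters the loop only in interval `n` or later. -/
def IsFuture (n : ℕ) : NoiseIdx → Prop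
  | .init => False
  | .process m => n ≤ m
  | .up m => n ≤ m
  | .down m => n ≤ m

theorem IsFuture.of_succ {n : ℕ} {i : NoiseIdx} (h : IsFuture (n + 1) i) : IsFuture n i := by
  cases i <;> simp only [IsFuture] at * <;> omega

/-- One step of the loop written out as a linear combination of the state and the three primitive
variables of the interval. With `g = 1 - 1/Γ` and `h = 1 - 1/S` the squared coefficients combine
through `(1 - g h)² + g² h (1 - h) + h g (1 - g) = 1 - g h`. -/
theorem state_succ (hb : s.b ≠ 0) (ζ : NoiseIdx → Ω' → ℂ) (S Γ : ℝ) (n : ℕ) :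
    ∃ A B C : ℂ, state s ν ζ S Γ (n + 1) = (fun ω => ((A * state s ν ζ S Γ n ω + B * ζ (.up n) ω)
        + C * ζ (.down n) ω) + ζ (.process n) ω) ∧
      (1 ≤ S → 1 ≤ Γ → Orth ν (state s ν ζ S Γ n) (ζ (.up n)) →
        MemLp (state s ν ζ S Γ n) 2 ν → MemLp (ζ (.up n)) 2 ν → meanSq ν (ζ (.up n)) = 1 →
        ‖A‖ ^ 2 * meanSq ν (state s ν ζ S Γ n) + ‖B‖ ^ 2 + ‖C‖ ^ 2 =
          ‖s.a‖ ^ 2 * (1 - (1 - 1 / S) * (1 - 1 / Γ)) * meanSq ν (state s ν ζ S Γ n)) := by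
  set x := state s ν ζ S Γ n with hx
  set V := meanSq ν x with hV
  set h : ℝ := 1 - 1 / S with hh
  set g : ℝ := 1 - 1 / Γ with hg
  set s₁ : ℝ := Real.sqrt (V / S * (1 - 1 / S)) with hs₁
  set d : Ω' → ℂ := fun ω => -(s.a / s.b) * reconstruct ν S x (ζ (.up n)) ω with hd
  set s₂ : ℝ := Real.sqrt (meanSq ν d / Γ * (1 - 1 / Γ)) with hs₂
  refine ⟨s.a * (1 - g * h), -(s.a * g * s₁), s.b * s₂, ?_, ?_⟩
  · funext ω
    show s.a * x ω + s.b * reconstruct ν Γ d (ζ (.down n)) ω + ζ (.process n) ω = _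
    have e₁ : reconstruct ν S x (ζ (.up n)) ω = h * x ω + s₁ * ζ (.up n) ω := rfl
    have e₂ : reconstruct ν Γ d (ζ (.down n)) ω
        = g * (-(s.a / s.b) * reconstruct ν S x (ζ (.up n)) ω) + s₂ * ζ (.down n) ω := rfl
    rw [e₂, e₁]
    clear_value s₁ s₂ g h
    field_simp
    ring
  · intro hS hΓ horth hx2 hu2 hu1
    have hS0 : 0 < S := by linarith
    have hΓ0 : 0 < Γ := by linarith
    have hSle : 1 / S ≤ 1 := by rw [div_le_one hS0]; exact hS
    have hΓle : 1 / Γ ≤ 1 := by rw [div_le_one hΓ0]; exact hΓ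
    have hV0 : 0 ≤ V := meanSq_nonneg _
    have hh0 : 0 ≤ h := by rw [hh]; linarith
    have hg0 : 0 ≤ g := by rw [hg]; linarith
    have e1 : s₁ ^ 2 = V * (1 - h) * h := by
      rw [hs₁, Real.sq_sqrt (mul_nonneg (div_nonneg hV0 hS0.le) hh0), hh]; ring
    have hdV : meanSq ν d = ‖s.a / s.b‖ ^ 2 * (h * V) := by
      have hrec : reconstruct ν S x (ζ (.up n)) = fun ω => (h : ℂ) * x ω + (s₁ : ℂ) * ζ (.up n) ω := by
        rfl
      rw [hd, meanSq_const_mul, hrec, meanSq_add (hx2.const_mul _) (hu2.const_mul _)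
        ((horth.const_mul_left _).const_mul_right _), meanSq_const_mul, meanSq_const_mul, hu1,
        norm_neg, ← hV, Complex.norm_real, Complex.norm_real, Real.norm_eq_abs, Real.norm_eq_abs,
        sq_abs, sq_abs, e1]
      ring
    have e2 : s₂ ^ 2 = ‖s.a / s.b‖ ^ 2 * (h * V) * (1 - g) * g := by
      rw [hs₂, Real.sq_sqrt (mul_nonneg (div_nonneg (meanSq_nonneg _) hΓ0.le) hg0), hdV, hg]; ring
    have nA : ‖s.a * (1 - g * h)‖ ^ 2 = ‖s.a‖ ^ 2 * (1 - g * h) ^ 2 := by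
      have : (1 - g * h : ℂ) = ((1 - g * h : ℝ) : ℂ) := by push_cast; ring
      rw [this, norm_mul, mul_pow, Complex.norm_real, Real.norm_eq_abs, sq_abs]
    have nB : ‖-(s.a * g * s₁)‖ ^ 2 = ‖s.a‖ ^ 2 * g ^ 2 * s₁ ^ 2 := by
      rw [norm_neg, norm_mul, norm_mul, Complex.norm_real, Complex.norm_real, mul_pow, mul_pow,
        Real.norm_eq_abs, Real.norm_eq_abs, sq_abs, sq_abs]
    have nC : ‖s.b * s₂‖ ^ 2 = ‖s.b‖ ^ 2 * s₂ ^ 2 := by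
      rw [norm_mul, Complex.norm_real, mul_pow, Real.norm_eq_abs, sq_abs]
    have hbn : ‖s.b‖ ≠ 0 := norm_ne_zero_iff.2 hb
    have e3 : ‖s.b‖ ^ 2 * s₂ ^ 2 = ‖s.a‖ ^ 2 * (h * V) * (1 - g) * g := by
      rw [e2, norm_div]; field_simp
    rw [nA, nB, nC, e3, e1]
    ring

/-- The state is square integrable and orthogonal to all primitive variables that have not yet
entered the loop. -/
theorem state_memLp_orth (hb : s.b ≠ 0) {ζ : NoiseIdx → Ω' → ℂ} (hζ : IsControlNoise s V0 ν ζ)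
    (S Γ : ℝ) (n : ℕ) :
    MemLp (state s ν ζ S Γ n) 2 ν ∧
      ∀ i, IsFuture n i → Orth ν (state s ν ζ S Γ n) (ζ i) := by
  induction n with
  | zero =>
    refine ⟨hζ.memLp _, fun i hi => hζ.orth ?_⟩
    rintro rfl
    exact hi
  | succ n ih =>
    obtain ⟨hm, ho⟩ := ih
    obtain ⟨A, B, C, hst, -⟩ := state_succ (ν := ν) hb ζ S Γ n
    have hu := (hζ.memLp (.up n)).const_mul B
    have hd := (hζ.memLp (.down n)).const_mul C
    have hp := hζ.memLp (.process n)
    have hA := hm.const_mul A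
    rw [hst]
    refine ⟨((hA.add hu).add hd).add hp, fun i hi => ?_⟩
    have hne : ∀ j, ¬ IsFuture (n + 1) j → j ≠ i := by rintro j hj rfl; exact hj hi
    have hi2 := hζ.memLp i
    refine Orth.add_left ((hA.add hu).add hd) hp hi2 (Orth.add_left (hA.add hu) hd hi2
      (Orth.add_left hA hu hi2 ((ho i hi.of_succ).const_mul_left A) ?_) ?_) ?_
    · exact (hζ.orth (hne _ (by simp [IsFuture]))).const_mul_left B
    · exact (hζ.orth (hne _ (by simp [IsFuture]))).const_mul_left C
    · exact hζ.orth (hne _ (by simp [IsFuture]))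

/-- The variance recursion `Vₙ₊₁ = |a|² (1 - (1 - 1/S)(1 - 1/Γ)) Vₙ + σ_w²`. -/
theorem meanSq_state_succ (hb : s.b ≠ 0) (hW : 0 ≤ s.varW) {ζ : NoiseIdx → Ω' → ℂ}
    (hζ : IsControlNoise s V0 ν ζ) {S Γ : ℝ} (hS : 1 ≤ S) (hΓ : 1 ≤ Γ) (n : ℕ) :
    meanSq ν (state s ν ζ S Γ (n + 1)) =
      ‖s.a‖ ^ 2 * (1 - (1 - 1 / S) * (1 - 1 / Γ)) * meanSq ν (state s ν ζ S Γ n) + s.varW := by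
  obtain ⟨hm, ho⟩ := state_memLp_orth (s := s) hb hζ S Γ n
  obtain ⟨A, B, C, hst, hABC⟩ := state_succ (ν := ν) hb ζ S Γ n
  have hu2 := hζ.memLp (.up n)
  have hu1 := meanSq_of_hasLaw zero_le_one (hζ.up_law n)
  have hu := hu2.const_mul B
  have hd := (hζ.memLp (.down n)).const_mul C
  have hp := hζ.memLp (.process n)
  have hA := hm.const_mul A
  have hud := hζ.orth (i := .up n) (j := .down n) (by simp)
  have hup := hζ.orth (i := .up n) (j := .process n) (by simp)
  have hdp := hζ.orth (i := .down n) (j := .process n) (by simp)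
  have hxu := ho (.up n) le_rfl
  have hxd := ho (.down n) le_rfl
  have hxp := ho (.process n) le_rfl
  have hAu : MemLp (fun ω => A * state s ν ζ S Γ n ω + B * ζ (.up n) ω) 2 ν := hA.add hu
  have hAud : MemLp (fun ω => A * state s ν ζ S Γ n ω + B * ζ (.up n) ω + C * ζ (.down n) ω) 2 ν :=
    hAu.add hd
  rw [hst, meanSq_add hAud hp, meanSq_add hAu hd, meanSq_add hA hu,
    meanSq_const_mul, meanSq_const_mul, meanSq_const_mul, hu1,
    meanSq_of_hasLaw zero_le_one (hζ.down_law n), meanSq_of_hasLaw hW (hζ.process_law n),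
    mul_one, mul_one, hABC hS hΓ hxu hm hu2 hu1]
  · exact (hxu.const_mul_left A).const_mul_right B
  · exact Orth.add_left hA hu hd ((hxd.const_mul_left A).const_mul_right C)
      ((hud.const_mul_left B).const_mul_right C)
  · exact Orth.add_left hAu hd hp (Orth.add_left hA hu hp (hxp.const_mul_left A)
      (hup.const_mul_left B)) (hdp.const_mul_left C)

/-- The control requirement in closed form: since `σ_w² > 0`, the affine variance recursion
converges iff its slope is below `1`, and its limit is the fixed point. -/
theorem controlOK_iff (hb : s.b ≠ 0) (hW : 0 < s.varW) (hVreq : s.varW < s.Vreq)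
    {ζ : NoiseIdx → Ω' → ℂ} (hζ : IsControlNoise s V0 ν ζ) {S Γ : ℝ} (hS : 1 ≤ S) (hΓ : 1 ≤ Γ) :
    ControlOK s ν ζ S Γ ↔
      ‖s.a‖ ^ 2 * (1 - (1 - 1 / S) * (1 - 1 / Γ)) * s.Vreq + s.varW ≤ s.Vreq := by
  have hrec := meanSq_state_succ hb hW.le hζ hS hΓ
  have hV0 : ∀ n, 0 ≤ meanSq ν (state s ν ζ S Γ n) := fun n => meanSq_nonneg _
  unfold ControlOK
  set V := fun n => meanSq ν (state s ν ζ S Γ n) with hV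
  set κ := ‖s.a‖ ^ 2 * (1 - (1 - 1 / S) * (1 - 1 / Γ)) with hκ
  have hκ0 : 0 ≤ κ := by
    have h1 : 1 / S ≤ 1 := by rw [div_le_one (by linarith)]; exact hS
    have h2 : 1 / Γ ≤ 1 := by rw [div_le_one (by linarith)]; exact hΓ
    have h3 : 0 ≤ 1 / S := by positivity
    have h4 : 0 ≤ 1 / Γ := by positivity
    refine mul_nonneg (by positivity) ?_
    nlinarith [mul_nonneg h3 (sub_nonneg.2 h2)]
  constructor
  · rintro ⟨W, hW1, hW2⟩
    have hfix : W = κ * W + s.varW := by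
      refine tendsto_nhds_unique (hW1.comp (tendsto_add_atTop_nat 1)) ?_
      refine ((hW1.const_mul κ).add_const s.varW).congr fun n => ?_
      exact (hrec n).symm
    have hW0 : 0 ≤ W := ge_of_tendsto' hW1 hV0
    have : κ < 1 := by by_contra hc; nlinarith
    nlinarith
  · intro h
    have hVr : 0 < s.Vreq := by linarith
    have hκ1 : κ < 1 := by by_contra hc; nlinarith
    have h1κ : 0 < 1 - κ := by linarith
    refine ⟨s.varW / (1 - κ), ?_, by rw [div_le_iff₀ h1κ]; linarith⟩
    have hform : ∀ n, V n = κ ^ n * (V 0 - s.varW / (1 - κ)) + s.varW / (1 - κ) := by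
      intro n
      induction n with
      | zero => simp
      | succ n ih =>
        have := hrec n
        simp only [hV] at ih ⊢
        rw [this, ih]
        field_simp
        ring
    rw [show V = fun n => κ ^ n * (V 0 - s.varW / (1 - κ)) + s.varW / (1 - κ) from funext hform]
    simpa using ((tendsto_pow_atTop_nhds_zero_of_lt_one hκ0 hκ1).mul_const
      (V 0 - s.varW / (1 - κ))).add_const (s.varW / (1 - κ))

end ControlLoop

/-! ### Unitary invariance of the channel law -/

theorem charFun_complexGaussian {v : ℝ} (hv : 0 ≤ v) (t : ℂ) :
    charFun (complexGaussian v) t = Complex.exp (-(v * ‖t‖ ^ 2 / 4 : ℝ)) := by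
  set g := gaussianReal 0 (v / 2).toNNReal with hg
  rw [charFun_apply, complexGaussian,
    integral_map measurable_complexMk.aemeasurable (by fun_prop), ← hg]
  have h : ∀ p : ℝ × ℝ, Complex.exp ((inner ℝ (⟨p.1, p.2⟩ : ℂ) t : ℝ) * Complex.I) =
      Complex.exp (t.re * p.1 * Complex.I) * Complex.exp (t.im * p.2 * Complex.I) := fun p => by
    rw [← Complex.exp_add, Complex.inner]
    congr 1
    simp
    ring
  simp only [h]
  rw [integral_prod_mul (μ := g) (ν := g) (fun x : ℝ => Complex.exp (t.re * x * Complex.I))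
    (fun x : ℝ => Complex.exp (t.im * x * Complex.I)), ← charFun_apply_real, ← charFun_apply_real,
    hg, charFun_gaussianReal, charFun_gaussianReal, ← Complex.exp_add,
    Real.coe_toNNReal _ (by positivity), Complex.sq_norm, Complex.normSq_apply]
  congr 1
  push_cast
  ring

instance isProbabilityMeasure_complexGaussianVector (M : ℕ) (v : ℝ) :
    IsProbabilityMeasure (complexGaussianVector M v) :=
  Measure.isProbabilityMeasure_map (by fun_prop)

/-- The real inner product on `ℂ^M` used for characteristic functions. -/
noncomputable local instance realInner (M : ℕ) : InnerProductSpace ℝ (EuclideanSpace ℂ (Fin M)) :=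
  inferInstanceAs (InnerProductSpace ℝ (PiLp 2 (fun _ : Fin M => ℂ)))

theorem charFun_complexGaussianVector (M : ℕ) {v : ℝ} (hv : 0 ≤ v)
    (t : EuclideanSpace ℂ (Fin M)) :
    charFun (complexGaussianVector M v) t = Complex.exp (-(v * ‖t‖ ^ 2 / 4 : ℝ)) := by
  rw [complexGaussianVector]
  erw [charFun_pi]
  simp only [charFun_complexGaussian hv]
  rw [← Complex.exp_sum, EuclideanSpace.norm_sq_eq]
  congr 1
  push_cast
  rw [Finset.sum_neg_distrib, Finset.mul_sum, Finset.sum_div]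

/-- Rotational symmetry of Rayleigh fading: the law `CN(0, v I_M)` is invariant under unitary
maps, because its characteristic function depends on the norm only. -/
theorem map_isometry_complexGaussianVector (M : ℕ) {v : ℝ} (hv : 0 ≤ v)
    (e : EuclideanSpace ℂ (Fin M) ≃ₗᵢ[ℂ] EuclideanSpace ℂ (Fin M)) :
    (complexGaussianVector M v).map e = complexGaussianVector M v := by
  have : IsProbabilityMeasure ((complexGaussianVector M v).map e) :=
    Measure.isProbabilityMeasure_map e.continuous.aemeasurable
  refine Measure.ext_of_charFun (funext fun t => ?_)
  let e' : EuclideanSpace ℂ (Fin M) ≃ₗᵢ[ℝ] EuclideanSpace ℂ (Fin M) :=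
    { e.toLinearEquiv.restrictScalars ℝ with norm_map' := e.norm_map }
  have h : ∀ x, inner ℝ (e x) t = inner ℝ x (e'.symm t) := fun x => by
    have := e'.inner_map_map x (e'.symm t)
    rw [e'.apply_symm_apply] at this
    exact this
  rw [charFun_apply, integral_map e.continuous.aemeasurable (by fun_prop)]
  simp only [h]
  rw [← charFun_apply, charFun_complexGaussianVector M hv, charFun_complexGaussianVector M hv,
    e'.symm.norm_map]

/-! ### The law of the channel gains -/

/-- The law `Gamma(M, 1)`, with density `fG M` on the positive reals. -/
noncomputable def erlang (M : ℕ) : Measure ℝ :=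
  (volume.restrict (Set.Ioi 0)).withDensity fun x => ENNReal.ofReal (fG M x)

@[fun_prop]
theorem measurable_fG (M : ℕ) : Measurable (fG M) := by unfold fG; fun_prop

@[fun_prop]
theorem measurable_fRho (M : ℕ) : Measurable (fRho M) := by unfold fRho; fun_prop

theorem fG_nonneg (M : ℕ) {x : ℝ} (hx : 0 ≤ x) : 0 ≤ fG M x := by unfold fG; positivity

theorem lintegral_erlang (M : ℕ) {F : ℝ → ℝ≥0∞} (hF : Measurable F) :
    ∫⁻ x, F x ∂erlang M = ∫⁻ x in Set.Ioi 0, ENNReal.ofReal (fG M x) * F x := by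
  rw [erlang, lintegral_withDensity_eq_lintegral_mul _ (by fun_prop) hF]
  rfl

instance sFinite_erlang (M : ℕ) : SFinite (erlang M) := by unfold erlang; infer_instance

instance isFiniteMeasure_erlang_one : IsFiniteMeasure (erlang 1) := by
  unfold erlang
  refine isFiniteMeasure_withDensity_ofReal ?_
  have := integrableOn_exp_neg_Ioi 0
  refine (this.congr (ae_of_all _ fun x => ?_)).2
  simp [fG]

theorem charFun_erlang_one (t : ℝ) : charFun (erlang 1) t = 1 / (1 - t * Complex.I) := by
  rw [charFun_apply_real, erlang, integral_withDensity_eq_integral_toReal_smul (by fun_prop)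
    (ae_of_all _ fun _ => ENNReal.ofReal_lt_top)]
  have h : ∀ x : ℝ, (ENNReal.ofReal (fG 1 x)).toReal • Complex.exp (t * x * Complex.I) =
      Complex.exp ((-1 + t * Complex.I) * x) := fun x => by
    have : fG 1 x = Real.exp (-x) := by simp [fG]
    rw [this, ENNReal.toReal_ofReal (Real.exp_pos _).le, Complex.real_smul, Complex.ofReal_exp,
      ← Complex.exp_add]
    congr 1
    push_cast
    ring
  simp only [h]
  rw [integral_exp_mul_complex_Ioi (by simp)]
  have h2 : (-1 + t * Complex.I : ℂ) = -(1 - t * Complex.I) := by ring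
  rw [h2, Complex.ofReal_zero, mul_zero, Complex.exp_zero, neg_div_neg_eq]

/-- The characteristic function of `x² / v` for `x ~ N(0, v / 2)` is `(1 - i t)^(-1/2)`; it is stated
squared to avoid the branch of the root. -/
theorem integral_cexp_sq_gaussianReal {v : ℝ} (hv : 0 < v) (t : ℝ) :
    (∫ x, Complex.exp (t * (x ^ 2 / v : ℝ) * Complex.I) ∂gaussianReal 0 (v / 2).toNNReal) ^ 2 =
      1 / (1 - t * Complex.I) := by
  have hw : (v / 2).toNNReal ≠ 0 := by simpa using hv
  have h1 : (1 - t * Complex.I : ℂ) ≠ 0 := by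
    intro h; have := congrArg Complex.re h; simp at this
  have hvc : (v : ℂ) ≠ 0 := by exact_mod_cast hv.ne'
  rw [integral_gaussianReal_eq_integral_smul hw]
  have h : ∀ x : ℝ, gaussianPDFReal 0 (v / 2).toNNReal x •
      Complex.exp (t * (x ^ 2 / v : ℝ) * Complex.I) =
      ((Real.sqrt (Real.pi * v))⁻¹ : ℝ) * Complex.exp (-((1 - t * Complex.I) / v) * x ^ 2) := by
    intro x
    rw [gaussianPDFReal, Real.coe_toNNReal _ (by positivity), Complex.real_smul,
      Complex.ofReal_mul, mul_assoc, Complex.ofReal_exp, ← Complex.exp_add,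
      show 2 * Real.pi * (v / 2) = Real.pi * v by ring]
    congr 2
    push_cast
    field_simp
    ring
  simp only [h]
  rw [integral_const_mul, integral_gaussian_complex]
  · rw [mul_pow, ← Complex.cpow_nat_mul]
    norm_num
    rw [← Complex.ofReal_pow, Real.sq_sqrt (by positivity)]
    have hpi : (Real.pi : ℂ) ≠ 0 := by exact_mod_cast Real.pi_ne_zero
    push_cast
    field_simp
  · have : ((1 - t * Complex.I) / v : ℂ).re = 1 / v := by
      rw [Complex.div_ofReal_re]; simp
    rw [this]; positivity

/-- The power of a complex Gaussian variable is exponentially distributed. -/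
theorem map_norm_sq_complexGaussian {v : ℝ} (hv : 0 < v) :
    (complexGaussian v).map (fun z => ‖z‖ ^ 2 / v) = erlang 1 := by
  have hm : Measurable (fun z : ℂ => ‖z‖ ^ 2 / v) := by fun_prop
  have : IsProbabilityMeasure ((complexGaussian v).map (fun z => ‖z‖ ^ 2 / v)) :=
    Measure.isProbabilityMeasure_map hm.aemeasurable
  refine Measure.ext_of_charFun (funext fun t => ?_)
  rw [charFun_erlang_one, charFun_apply_real, integral_map hm.aemeasurable (by fun_prop),
    complexGaussian, integral_map measurable_complexMk.aemeasurable (by fun_prop)]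
  set g := gaussianReal 0 (v / 2).toNNReal with hg
  have h : ∀ p : ℝ × ℝ, Complex.exp (t * (‖(⟨p.1, p.2⟩ : ℂ)‖ ^ 2 / v : ℝ) * Complex.I) =
      Complex.exp (t * (p.1 ^ 2 / v : ℝ) * Complex.I) *
        Complex.exp (t * (p.2 ^ 2 / v : ℝ) * Complex.I) := fun p => by
    rw [← Complex.exp_add, Complex.sq_norm, Complex.normSq_mk]
    congr 1
    push_cast
    ring
  simp only [h]
  rw [integral_prod_mul (μ := g) (ν := g)
    (fun x : ℝ => Complex.exp (t * (x ^ 2 / v : ℝ) * Complex.I))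
    (fun x : ℝ => Complex.exp (t * (x ^ 2 / v : ℝ) * Complex.I)), ← sq, hg,
    integral_cexp_sq_gaussianReal hv]

theorem lintegral_scale {y : ℝ} (hy : 0 < y) (g : ℝ → ℝ≥0∞) (hg : Measurable g) :
    ∫⁻ e, g e = ENNReal.ofReal y * ∫⁻ r, g (y * r) := by
  conv_lhs => rw [← Real.smul_map_volume_mul_left hy.ne', abs_of_pos hy]
  rw [lintegral_smul_measure, lintegral_map hg (by fun_prop), smul_eq_mul]

/-- The change of variables `(e, ρ) ↦ (r, y) = (e / (e + ρ), e + ρ)`: for independent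
`e ~ Gamma(1, 1)` and `ρ ~ Gamma(n + 1, 1)`, the ratio `r ~ Beta(1, n + 1)` and the sum
`y ~ Gamma(n + 2, 1)` are independent. -/
theorem lintegral_erlang_ratio_sum (n : ℕ) {F : ℝ → ℝ → ℝ≥0∞}
    (hF : Measurable (Function.uncurry F)) :
    ∫⁻ e, ∫⁻ ρ, F (e / (e + ρ)) (e + ρ) ∂erlang (n + 1) ∂erlang 1 =
      ∫⁻ y, (∫⁻ r in Set.Ioo 0 1, ENNReal.ofReal (fRho (n + 2) r) * F r y) ∂erlang (n + 2) := by
  have hF2 : ∀ {α : Type} [MeasurableSpace α] {a b : α → ℝ}, Measurable a → Measurable b →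
      Measurable fun x => F (a x) (b x) := fun ha hb => hF.comp (ha.prodMk hb)
  -- the joint density in the variables `(e, y)`
  set k : ℝ → ℝ → ℝ≥0∞ := fun e y =>
    ENNReal.ofReal (Real.exp (-y) * (y - e) ^ n / n.factorial) * F (e / y) y with hk
  have hkm : Measurable (Function.uncurry k) := by
    refine Measurable.mul (by fun_prop) (hF2 (by fun_prop) (by fun_prop))
  set T : Set (ℝ × ℝ) := {p | 0 < p.1 ∧ p.1 < p.2} with hT
  have hTm : MeasurableSet T :=
    (measurableSet_lt measurable_const measurable_fst).inter
      (measurableSet_lt measurable_fst measurable_snd)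
  have hTk : Measurable (T.indicator (Function.uncurry k)) := hkm.indicator hTm
  have hL : ∫⁻ e, ∫⁻ ρ, F (e / (e + ρ)) (e + ρ) ∂erlang (n + 1) ∂erlang 1 =
      ∫⁻ e, ∫⁻ y, T.indicator (Function.uncurry k) (e, y) := by
    rw [lintegral_erlang 1 (Measurable.lintegral_prod_right'
      (f := fun p : ℝ × ℝ => F (p.1 / (p.1 + p.2)) (p.1 + p.2))
      (hF2 (by fun_prop) (by fun_prop))), ← lintegral_indicator measurableSet_Ioi]
    refine lintegral_congr fun e => ?_
    by_cases he : 0 < e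
    · rw [Set.indicator_of_mem (Set.mem_Ioi.2 he),
        lintegral_erlang (n + 1) (hF2 (by fun_prop) (by fun_prop)),
        ← lintegral_const_mul' _ _ ENNReal.ofReal_ne_top, ← lintegral_indicator measurableSet_Ioi,
        ← lintegral_add_left_eq_self (fun y => T.indicator (Function.uncurry k) (e, y)) e]
      refine lintegral_congr fun ρ => ?_
      by_cases hρ : 0 < ρ
      · rw [Set.indicator_of_mem (Set.mem_Ioi.2 hρ),
          Set.indicator_of_mem (show (e, e + ρ) ∈ T from ⟨he, by simpa using hρ⟩), hk]
        simp only [Function.uncurry]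
        rw [← mul_assoc, ← ENNReal.ofReal_mul (fG_nonneg 1 he.le)]
        congr 2
        simp only [fG, add_tsub_cancel_right, add_sub_cancel_left, neg_add, Real.exp_add]
        simp
        ring
      · rw [Set.indicator_of_notMem (by simpa using hρ), Set.indicator_of_notMem]
        rintro ⟨-, h⟩
        exact hρ (by simpa using h)
    · rw [Set.indicator_of_notMem (by simpa using he)]
      rw [lintegral_congr (g := fun _ => 0) fun y =>
        Set.indicator_of_notMem (fun h : (e, y) ∈ T => he h.1) _, lintegral_zero]
  rw [hL, lintegral_lintegral_swap
    (f := fun e y => T.indicator (Function.uncurry k) (e, y)) hTk.aemeasurable,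
    lintegral_erlang (n + 2) (Measurable.lintegral_prod_right'
      (f := fun p : ℝ × ℝ => ENNReal.ofReal (fRho (n + 2) p.2) * F p.2 p.1)
      (Measurable.mul (by fun_prop) (hF2 (by fun_prop) (by fun_prop)))),
    ← lintegral_indicator measurableSet_Ioi]
  refine lintegral_congr fun y => ?_
  by_cases hy : 0 < y
  · rw [Set.indicator_of_mem (Set.mem_Ioi.2 hy), lintegral_scale hy
        (fun e => T.indicator (Function.uncurry k) (e, y)) (hTk.comp (by fun_prop)),
      ← lintegral_indicator measurableSet_Ioo, ← lintegral_const_mul' _ _ ENNReal.ofReal_ne_top,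
      ← lintegral_const_mul' _ _ ENNReal.ofReal_ne_top]
    refine lintegral_congr fun r => ?_
    by_cases hr : r ∈ Set.Ioo (0 : ℝ) 1
    · have hmem : (y * r, y) ∈ T := ⟨mul_pos hy hr.1, by simpa using mul_lt_mul_of_pos_left hr.2 hy⟩
      rw [Set.indicator_of_mem hr, Set.indicator_of_mem hmem, hk]
      simp only [Function.uncurry]
      rw [mul_div_cancel_left₀ _ hy.ne', ← mul_assoc, ← mul_assoc, ← ENNReal.ofReal_mul hy.le,
        ← ENNReal.ofReal_mul (fG_nonneg _ hy.le)]
      congr 2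
      simp only [fG, fRho, Nat.add_sub_cancel, show n + 2 - 1 = n + 1 from rfl,
        show y - y * r = y * (1 - r) by ring, mul_pow, Nat.factorial_succ]
      have : (n.factorial : ℝ) ≠ 0 := by positivity
      have : (n + 1 : ℝ) ≠ 0 := by positivity
      push_cast
      field_simp
      ring
    · rw [Set.indicator_of_notMem hr, mul_zero, Set.indicator_of_notMem, mul_zero]
      rintro ⟨h1, h2⟩
      simp only at h1 h2
      exact hr ⟨pos_of_mul_pos_right h1 hy.le, by nlinarith⟩
  · rw [Set.indicator_of_notMem (by simpa using hy)]
    rw [lintegral_congr (g := fun _ => 0) fun e =>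
      Set.indicator_of_notMem (fun h : (e, y) ∈ T => hy (h.1.trans h.2)) _, lintegral_zero]

theorem lintegral_fRho (n : ℕ) :
    ∫⁻ r in Set.Ioo (0 : ℝ) 1, ENNReal.ofReal (fRho (n + 2) r) = 1 := by
  have hd : ∀ r ∈ Set.uIcc (0 : ℝ) 1, HasDerivAt (fun r : ℝ => -(1 - r) ^ (n + 1))
      (fRho (n + 2) r) r := fun r _ => by
    have := (((hasDerivAt_id r).const_sub 1).pow (n + 1)).neg
    refine this.congr_deriv ?_
    simp only [fRho, id, Nat.add_sub_cancel]
    push_cast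
    ring
  have hc : Continuous (fRho (n + 2)) := by unfold fRho; fun_prop
  have hint : ∫ r in (0 : ℝ)..1, fRho (n + 2) r = 1 := by
    rw [intervalIntegral.integral_eq_sub_of_hasDerivAt hd (hc.intervalIntegrable _ _)]
    simp
  rw [intervalIntegral.integral_of_le zero_le_one, integral_Ioc_eq_integral_Ioo] at hint
  rw [← ofReal_integral_eq_lintegral_ofReal, hint, ENNReal.ofReal_one]
  · exact (hc.integrableOn_Icc).mono_set Set.Ioo_subset_Icc_self
  · refine (ae_restrict_iff' measurableSet_Ioo).2 (ae_of_all _ fun r hr => ?_)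
    have : 0 ≤ 1 - r := by linarith [hr.2]
    simp only [fRho, Pi.zero_apply]
    push_cast
    refine mul_nonneg (by linarith [(Nat.cast_nonneg n : (0:ℝ) ≤ n)]) (by positivity)

theorem lintegral_pi_succ {n : ℕ} (v : ℝ) {G : (Fin (n + 1) → ℂ) → ℝ≥0∞} (hG : Measurable G) :
    ∫⁻ z, G z ∂Measure.pi (fun _ : Fin (n + 1) => complexGaussian v) =
      ∫⁻ a, ∫⁻ w, G (Fin.cons a w) ∂Measure.pi (fun _ : Fin n => complexGaussian v)
        ∂complexGaussian v := by
  have hp := (measurePreserving_piFinSuccAbove (fun _ : Fin (n + 1) => complexGaussian v) 0).symm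
  rw [← hp.lintegral_comp hG]
  refine (lintegral_prod (μ := complexGaussian v) (ν := Measure.pi fun _ : Fin n =>
    complexGaussian v) _ (hG.comp hp.measurable).aemeasurable).trans ?_
  refine lintegral_congr fun a => lintegral_congr fun w => ?_
  simp [MeasurableEquiv.piFinSuccAbove, Fin.insertNthEquiv]

theorem lintegral_norm_sq_complexGaussian {v : ℝ} (hv : 0 < v) {G : ℝ → ℝ≥0∞} (hG : Measurable G) :
    ∫⁻ z, G (‖z‖ ^ 2 / v) ∂complexGaussian v = ∫⁻ x, G x ∂erlang 1 := by
  rw [← map_norm_sq_complexGaussian hv, lintegral_map hG (by fun_prop)]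

/-- `‖z‖² / v ~ Gamma(n + 1, 1)` for `z ~ CN(0, v I)` in dimension `n + 1`. -/
theorem lintegral_pi_sum_norm_sq {v : ℝ} (hv : 0 < v) (n : ℕ) {G : ℝ → ℝ≥0∞} (hG : Measurable G) :
    ∫⁻ z, G (∑ i, ‖z i‖ ^ 2 / v) ∂Measure.pi (fun _ : Fin (n + 1) => complexGaussian v) =
      ∫⁻ x, G x ∂erlang (n + 1) := by
  induction n generalizing G with
  | zero =>
    rw [lintegral_pi_succ v (by fun_prop), Measure.pi_of_empty]
    simp only [lintegral_dirac]
    simpa using lintegral_norm_sq_complexGaussian hv hG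
  | succ n ih =>
    rw [lintegral_pi_succ v (by fun_prop)]
    have h0 : ∀ (a : ℂ) (w : Fin (n + 1) → ℂ),
        ∑ i, ‖(Fin.cons a w : Fin (n + 2) → ℂ) i‖ ^ 2 / v = ‖a‖ ^ 2 / v + ∑ i, ‖w i‖ ^ 2 / v :=
      fun a w => by rw [Fin.sum_univ_succ]; simp only [Fin.cons_zero, Fin.cons_succ]
    simp only [h0]
    have h1 : ∀ a : ℝ, ∫⁻ w, G (a + ∑ i, ‖w i‖ ^ 2 / v)
        ∂Measure.pi (fun _ : Fin (n + 1) => complexGaussian v) =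
        ∫⁻ ρ, G (a + ρ) ∂erlang (n + 1) := fun a =>
      ih (G := fun ρ => G (a + ρ)) (by fun_prop)
    have h2 : Measurable fun e => ∫⁻ ρ, G (e + ρ) ∂erlang (n + 1) :=
      Measurable.lintegral_prod_right' (f := fun p : ℝ × ℝ => G (p.1 + p.2)) (by fun_prop)
    show _ = ∫⁻ x, G x ∂erlang (n + 2)
    simp only [h1]
    rw [lintegral_norm_sq_complexGaussian hv h2,
      lintegral_erlang_ratio_sum n (F := fun _ y => G y) (by unfold Function.uncurry; fun_prop)]
    refine lintegral_congr fun y => ?_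
    rw [lintegral_mul_const _ (by fun_prop), lintegral_fRho, one_mul]

/-- The share of the first entry in `‖z‖²` is `Beta(1, n + 1)`, independent of
`‖z‖² / v ~ Gamma(n + 2, 1)`. -/
theorem lintegral_pi_ratio_sum {v : ℝ} (hv : 0 < v) (n : ℕ) {F : ℝ → ℝ → ℝ≥0∞}
    (hF : Measurable (Function.uncurry F)) :
    ∫⁻ z, F (‖z 0‖ ^ 2 / v / ∑ i, ‖z i‖ ^ 2 / v) (∑ i, ‖z i‖ ^ 2 / v)
        ∂Measure.pi (fun _ : Fin (n + 2) => complexGaussian v) =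
      ∫⁻ y, (∫⁻ r in Set.Ioo 0 1, ENNReal.ofReal (fRho (n + 2) r) * F r y) ∂erlang (n + 2) := by
  have hF2 : ∀ {α : Type} [MeasurableSpace α] {a b : α → ℝ}, Measurable a → Measurable b →
      Measurable fun x => F (a x) (b x) := fun ha hb => hF.comp (ha.prodMk hb)
  rw [lintegral_pi_succ v (hF2 (by fun_prop) (by fun_prop)), ← lintegral_erlang_ratio_sum n hF]
  have h1 : ∀ a : ℝ, ∫⁻ w, F (a / (a + ∑ i, ‖w i‖ ^ 2 / v)) (a + ∑ i, ‖w i‖ ^ 2 / v)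
      ∂Measure.pi (fun _ : Fin (n + 1) => complexGaussian v) =
      ∫⁻ ρ, F (a / (a + ρ)) (a + ρ) ∂erlang (n + 1) := fun a =>
    lintegral_pi_sum_norm_sq hv n (G := fun ρ => F (a / (a + ρ)) (a + ρ))
      (hF2 (by fun_prop) (by fun_prop))
  have h2 : Measurable fun e => ∫⁻ ρ, F (e / (e + ρ)) (e + ρ) ∂erlang (n + 1) :=
    Measurable.lintegral_prod_right' (f := fun p : ℝ × ℝ => F (p.1 / (p.1 + p.2)) (p.1 + p.2))
      (hF2 (by fun_prop) (by fun_prop))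
  rw [← lintegral_norm_sq_complexGaussian hv h2]
  refine lintegral_congr fun a => ?_
  rw [← h1]
  refine lintegral_congr fun w => ?_
  rw [Fin.sum_univ_succ]
  simp only [Fin.cons_zero, Fin.cons_succ]

theorem lintegral_complexGaussianVector_norm {v : ℝ} (hv : 0 < v) (n : ℕ) {G : ℝ → ℝ≥0∞}
    (hG : Measurable G) :
    ∫⁻ h, G (‖h‖ ^ 2 / v) ∂complexGaussianVector (n + 1) v = ∫⁻ x, G x ∂erlang (n + 1) := by
  rw [← lintegral_pi_sum_norm_sq hv n hG, complexGaussianVector,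
    lintegral_map (by fun_prop) (by fun_prop)]
  refine lintegral_congr fun z => ?_
  rw [EuclideanSpace.norm_sq_eq, Finset.sum_div]

instance isProbabilityMeasure_erlang (n : ℕ) : IsProbabilityMeasure (erlang (n + 1)) := by
  constructor
  have := lintegral_complexGaussianVector_norm one_pos n (G := fun _ => 1) (by fun_prop)
  simpa using this.symm

/-- The squared cosine of the angle between a channel `h ~ CN(0, v I)` and a fixed direction `g` is
`Beta(1, n + 1)` and independent of the gain `‖h‖² / v ~ Gamma(n + 2, 1)`: a unitary map takes `g`
to the first axis without changing the law of `h`. -/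
theorem lintegral_complexGaussianVector_angle {v : ℝ} (hv : 0 < v) (n : ℕ)
    {g : EuclideanSpace ℂ (Fin (n + 2))} (hg : g ≠ 0) {F : ℝ → ℝ → ℝ≥0∞}
    (hF : Measurable (Function.uncurry F)) :
    ∫⁻ h, F (‖inner ℂ g h‖ ^ 2 / (‖g‖ ^ 2 * ‖h‖ ^ 2)) (‖h‖ ^ 2 / v)
        ∂complexGaussianVector (n + 2) v =
      ∫⁻ y, (∫⁻ r in Set.Ioo 0 1, ENNReal.ofReal (fRho (n + 2) r) * F r y) ∂erlang (n + 2) := by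
  have hgn : ‖g‖ ≠ 0 := norm_ne_zero_iff.2 hg
  obtain ⟨b, hb⟩ := Orthonormal.exists_orthonormalBasis_extension_of_card_eq (𝕜 := ℂ)
    (E := EuclideanSpace ℂ (Fin (n + 2))) (ι := Fin (n + 2)) (by simp)
    (v := fun _ => ((‖g‖⁻¹ : ℝ) : ℂ) • g) (s := {0}) (by
      constructor
      · rintro ⟨i, hi⟩
        simp [norm_smul, hgn]
      · rintro ⟨i, hi⟩ ⟨j, hj⟩ hij
        exact absurd (Subtype.ext (hi.trans hj.symm)) hij)
  have hb0 : b 0 = ((‖g‖⁻¹ : ℝ) : ℂ) • g := hb 0 rfl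
  have hF2 : ∀ {α : Type} [MeasurableSpace α] {a b : α → ℝ}, Measurable a → Measurable b →
      Measurable fun x => F (a x) (b x) := fun ha hb => hF.comp (ha.prodMk hb)
  have key : ∀ h, F (‖inner ℂ g h‖ ^ 2 / (‖g‖ ^ 2 * ‖h‖ ^ 2)) (‖h‖ ^ 2 / v) =
      F (‖(b.repr h) 0‖ ^ 2 / ‖b.repr h‖ ^ 2) (‖b.repr h‖ ^ 2 / v) := fun h => by
    rw [b.repr.norm_map, b.repr_apply_apply, hb0, inner_smul_left, norm_mul]
    congr 1
    simp only [RCLike.norm_conj, Complex.norm_real, norm_inv, norm_norm]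
    field_simp
  simp only [key]
  have hm : Measurable fun z : EuclideanSpace ℂ (Fin (n + 2)) =>
      F (‖z 0‖ ^ 2 / ‖z‖ ^ 2) (‖z‖ ^ 2 / v) := hF2 (by fun_prop) (by fun_prop)
  rw [← lintegral_map hm (b.repr.continuous.measurable),
    map_isometry_complexGaussianVector _ hv.le, ← lintegral_pi_ratio_sum hv n hF,
    complexGaussianVector, lintegral_map hm (by fun_prop)]
  refine lintegral_congr fun z => ?_
  rw [EuclideanSpace.norm_sq_eq, ← Finset.sum_div, div_div_div_cancel_right₀ hv.ne']

/-! ### Success for a fixed channel realization -/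

section Deterministic

variable {s : System}

theorem gammaUreq_pos (hQU : 0 < s.QU) (hBdn : 0 < s.Bdn) (htau : 0 < s.tauReq) :
    0 < s.gammaUreq := by
  have : (1 : ℝ) < 2 ^ (s.QU / (s.Bdn * s.tauReq)) :=
    Real.one_lt_rpow one_lt_two (by positivity)
  unfold System.gammaUreq
  linarith

theorem delay_le_iff (hQU : 0 < s.QU) (hBdn : 0 < s.Bdn) (htau : 0 < s.tauReq) {Γ : ℝ}
    (hΓ : 0 ≤ Γ) : delay s Γ ≤ ENNReal.ofReal s.tauReq ↔ s.gammaUreq ≤ Γ := by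
  have hg := gammaUreq_pos hQU hBdn htau
  unfold delay
  rcases hΓ.eq_or_lt with h0 | hpos
  · -- zero rate: the delay is `∞`
    subst h0
    rw [add_zero, Real.logb_one, mul_zero, ENNReal.ofReal_zero, ENNReal.div_zero (by simpa using hQU)]
    simpa using hg
  · have hR : 0 < s.Bdn * Real.logb 2 (1 + Γ) :=
      mul_pos hBdn (Real.logb_pos one_lt_two (by linarith))
    rw [← ENNReal.ofReal_div_of_pos hR, ENNReal.ofReal_le_ofReal_iff htau.le, div_le_iff₀ hR,
      System.gammaUreq, sub_le_iff_le_add', ← Real.le_logb_iff_rpow_le one_lt_two (by linarith),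
      div_le_iff₀ (by positivity)]
    constructor <;> intro h <;> linarith

theorem norm_inner_mrtBeam_self {M : ℕ} {p : ℝ} (hp : 0 ≤ p) {h : EuclideanSpace ℂ (Fin M)}
    (hh : h ≠ 0) : ‖inner ℂ h (mrtBeam p h)‖ ^ 2 = p * ‖h‖ ^ 2 := by
  have hn : ‖h‖ ≠ 0 := norm_ne_zero_iff.2 hh
  rw [mrtBeam, inner_smul_right, norm_mul, inner_self_eq_norm_sq_to_K, Complex.norm_real, norm_div,
    norm_norm, mul_pow, div_pow, Real.norm_eq_abs, sq_abs, Real.sq_sqrt hp, norm_pow]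
  simp only [Complex.coe_algebraMap, Complex.norm_real, norm_norm]
  field_simp

theorem norm_inner_mrtBeam {M : ℕ} {p : ℝ} (hp : 0 ≤ p) (h g : EuclideanSpace ℂ (Fin M)) :
    ‖inner ℂ h (mrtBeam p g)‖ ^ 2 = p * (‖inner ℂ h g‖ ^ 2 / ‖g‖ ^ 2) := by
  rw [mrtBeam, inner_smul_right, norm_mul, Complex.norm_real, norm_div, norm_norm, mul_pow, div_pow,
    Real.norm_eq_abs, sq_abs, Real.sq_sqrt hp]
  ring

theorem sinr_nonneg {M : ℕ} (h w w' : EuclideanSpace ℂ (Fin M)) {σ : ℝ} (hσ : 0 ≤ σ) :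
    0 ≤ sinr h w w' σ := by
  unfold sinr; positivity

/-- The condition on the steady-state variance, solved for the downlink quality `Γ`. If
`S (V - W) ≤ A V` no `Γ` suffices. -/
theorem variance_le_iff {A V W S Γ : ℝ} (hA : 1 < A) (hW : 0 < W) (hVW : W < V) (hS : 1 ≤ S)
    (hΓ : 1 ≤ Γ) :
    A * (1 - (1 - 1 / S) * (1 - 1 / Γ)) * V + W ≤ V ↔
      A * V < S * (V - W) ∧ A * V * (S - 1) / (S * (V - W) - A * V) ≤ Γ := by
  have hS0 : 0 < S := by linarith
  have hΓ0 : 0 < Γ := by linarith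
  have hAV : V < A * V := by nlinarith
  have e1 : A * (1 - (1 - 1 / S) * (1 - 1 / Γ)) * V + W ≤ V ↔
      A * V * (S - 1) ≤ Γ * (S * (V - W) - A * V) := by
    have : A * (1 - (1 - 1 / S) * (1 - 1 / Γ)) * V = A * V * (Γ + S - 1) / (S * Γ) := by
      field_simp
      ring
    rw [this, ← le_sub_iff_add_le, div_le_iff₀ (by positivity)]
    constructor <;> intro h <;> linarith
  rw [e1]
  constructor
  · intro h
    have hlt : A * V < S * (V - W) := by
      by_contra hc
      have h1 : A * V * (S - 1) ≤ 0 :=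
        h.trans (mul_nonpos_of_nonneg_of_nonpos hΓ0.le (by linarith))
      have h2 : S - 1 ≤ 0 := by
        by_contra h3
        have : 0 < A * V * (S - 1) := mul_pos (by linarith) (by linarith)
        linarith
      have h3 : S = 1 := by linarith
      subst h3
      nlinarith
    exact ⟨hlt, by rwa [div_le_iff₀ (by linarith)]⟩
  · rintro ⟨h1, h2⟩
    rwa [div_le_iff₀ (by linarith)] at h2

/-- The positivity hypotheses on the parameters that the closed formula rests on. -/
structure System.Valid (s : System) : Prop where
  ha : 1 < ‖s.a‖
  hb : s.b ≠ 0
  hW : 0 < s.varW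
  hPup : 0 < s.Pup
  hPdn : 0 < s.Pdn
  hBup : 0 < s.Bup
  hBdn : 0 < s.Bdn
  hTs : 0 < s.Ts
  hN0 : 0 < s.N0
  hbetaD : 0 < s.betaD
  hbetaU : 0 < s.betaU
  hQU : 0 < s.QU
  htau : 0 < s.tauReq
  hVreq : s.varW < s.Vreq

namespace System.Valid

theorem varUp_pos (hs : s.Valid) : 0 < s.varUp := mul_pos hs.hN0 hs.hBup
theorem varDn_pos (hs : s.Valid) : 0 < s.varDn := mul_pos hs.hN0 hs.hBdn
theorem alphaUp_pos (hs : s.Valid) : 0 < s.alphaUp := mul_pos hs.hBup hs.hTs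
theorem alphaDn_pos (hs : s.Valid) : 0 < s.alphaDn := mul_pos hs.hBdn hs.hTs
theorem gbarUp_pos (hs : s.Valid) : 0 < s.gbarUp := div_pos (mul_pos hs.hPup hs.hbetaD) hs.varUp_pos
theorem gbarD_pos (hs : s.Valid) : 0 < s.gbarD := div_pos (mul_pos hs.hPdn hs.hbetaD) hs.varDn_pos
theorem gammaUreq_pos (hs : s.Valid) : 0 < s.gammaUreq := JDCC.gammaUreq_pos hs.hQU hs.hBdn hs.htau
theorem etaU_pos (hs : s.Valid) : 0 < s.etaU :=
  div_pos (mul_pos hs.gammaUreq_pos hs.varDn_pos) (mul_pos hs.hPdn hs.hbetaU)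
theorem Vreq_pos (hs : s.Valid) : 0 < s.Vreq := hs.hW.trans hs.hVreq
theorem one_lt_sq (hs : s.Valid) : 1 < ‖s.a‖ ^ 2 := by nlinarith [hs.ha]

theorem one_lt_ratio (hs : s.Valid) : 1 < ‖s.a‖ ^ 2 * s.Vreq / (s.Vreq - s.varW) := by
  have h1 := hs.hVreq
  have h2 := hs.one_lt_sq
  have h3 := hs.Vreq_pos
  have h4 := hs.hW
  rw [one_lt_div (by linarith)]
  nlinarith

theorem etaV_pos (hs : s.Valid) : 0 < s.etaV := by
  have := Real.one_lt_rpow hs.one_lt_ratio (one_div_pos.2 hs.alphaUp_pos)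
  exact mul_pos (one_div_pos.2 hs.gbarUp_pos) (by linarith)

theorem one_le_Salpha (hs : s.Valid) {x : ℝ} (hx : 0 ≤ x) : 1 ≤ s.Salpha x :=
  Real.one_le_rpow (by have := hs.gbarUp_pos; nlinarith) hs.alphaUp_pos.le

theorem etaV_lt_iff (hs : s.Valid) {x : ℝ} (hx : 0 ≤ x) :
    s.etaV < x ↔ ‖s.a‖ ^ 2 * s.Vreq < s.Salpha x * (s.Vreq - s.varW) := by
  have hg := hs.gbarUp_pos
  have h1 : 0 < s.Vreq - s.varW := by linarith [hs.hVreq]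
  rw [System.etaV, ← div_lt_iff₀ h1, one_div_mul_eq_div, div_lt_iff₀ hg, sub_lt_iff_lt_add',
    one_div, Real.rpow_inv_lt_iff_of_pos (zero_le_one.trans hs.one_lt_ratio.le) (by nlinarith)
      hs.alphaUp_pos, System.Salpha, mul_comm x]

/-- Above the threshold `η_V` the required downlink quality exceeds `1`. -/
theorem one_lt_quality (hs : s.Valid) {x : ℝ} (hx : s.etaV < x) :
    1 < ‖s.a‖ ^ 2 * s.Vreq * (s.Salpha x - 1) /
      (s.Salpha x * (s.Vreq - s.varW) - ‖s.a‖ ^ 2 * s.Vreq) := by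
  have hx0 := hs.etaV_pos.le.trans hx.le
  have h1 := (hs.etaV_lt_iff hx0).1 hx
  have h2 := hs.one_le_Salpha hx0
  have h3 : s.Vreq < ‖s.a‖ ^ 2 * s.Vreq := by nlinarith [hs.one_lt_sq, hs.Vreq_pos]
  rw [one_lt_div (by linarith)]
  nlinarith [hs.hW]

theorem gammaDreq_pos (hs : s.Valid) {x : ℝ} (hx : s.etaV < x) : 0 < s.gammaDreq x := by
  have := Real.one_lt_rpow (hs.one_lt_quality hx) (one_div_pos.2 hs.alphaDn_pos)
  unfold System.gammaDreq
  linarith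

theorem etaf_pos (hs : s.Valid) {x : ℝ} (hx : s.etaV < x) : 0 < s.etaf x :=
  div_pos (hs.gammaDreq_pos hx) hs.gbarD_pos

/-- The control requirement in terms of the uplink gain `x` and the downlink SINR `q`. -/
theorem controlOK_iff_gamma (hs : s.Valid) {V0 : ℝ} {Ω' : Type*} [MeasurableSpace Ω'] {ν : Measure Ω'}
    {ζ : NoiseIdx → Ω' → ℂ} (hζ : IsControlNoise s V0 ν ζ) {x q : ℝ} (hx : 0 ≤ x) (hq : 0 ≤ q) :
    ControlOK s ν ζ (s.Salpha x) ((1 + q) ^ s.alphaDn) ↔ s.etaV < x ∧ s.gammaDreq x ≤ q := by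
  rw [controlOK_iff hs.hb hs.hW hs.hVreq hζ (hs.one_le_Salpha hx)
    (Real.one_le_rpow (by linarith) hs.alphaDn_pos.le), variance_le_iff hs.one_lt_sq hs.hW hs.hVreq
    (hs.one_le_Salpha hx) (Real.one_le_rpow (by linarith) hs.alphaDn_pos.le), ← hs.etaV_lt_iff hx]
  refine and_congr_right fun h => ?_
  rw [System.gammaDreq, sub_le_iff_le_add', one_div, Real.rpow_inv_le_iff_of_pos
    (zero_le_one.trans (hs.one_lt_quality h).le) (by linarith) hs.alphaDn_pos]

end System.Valid

/-- Feasibility of a power split: a fraction `d` for one user and `1 - d` for the other can meet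
both linear SINR constraints iff the two smallest admissible fractions add up to at most `1`. -/
theorem exists_split_iff {u v r A B : ℝ} (hu : 0 ≤ u) (hv : 0 ≤ v) (hr : 0 ≤ r) (hA : 0 ≤ A)
    (hB : 0 ≤ B) :
    (∃ d ∈ Set.Icc (0 : ℝ) 1, u * r * d + A ≤ 1 - d ∧ v * r * (1 - d) + B ≤ d) ↔
      A * (1 + v * r) + B * (1 + u * r) ≤ 1 - u * v * r ^ 2 := by
  have h1 : 0 < 1 + v * r := by positivity
  have h2 : 0 < 1 + u * r := by positivity
  constructor
  · rintro ⟨d, -, h3, h4⟩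
    have h5 : (v * r + B) * (1 + u * r) ≤ d * (1 + v * r) * (1 + u * r) :=
      mul_le_mul_of_nonneg_right (by linarith) h2.le
    have h6 : d * (1 + u * r) * (1 + v * r) ≤ (1 - A) * (1 + v * r) :=
      mul_le_mul_of_nonneg_right (by linarith) h1.le
    nlinarith
  · intro h
    set d := (v * r + B) / (1 + v * r) with hd
    have hd0 : 0 ≤ d := by positivity
    have hd1 : d * (1 + v * r) = v * r + B := by rw [hd]; field_simp
    have hd2 : d * (1 + u * r) ≤ 1 - A := by
      rw [hd, div_mul_eq_mul_div, div_le_iff₀ h1]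
      nlinarith
    have hur : 0 ≤ u * r := by positivity
    refine ⟨d, ⟨hd0, by nlinarith⟩, by linarith, by linarith⟩

/-- The feasibility condition of `exists_split_iff`, solved for the gain `y`. -/
theorem feasible_iff {u v r a f x y : ℝ} (hu : 0 ≤ u) (hv : 0 ≤ v) (hr : 0 ≤ r) (ha : 0 < a)
    (hf : 0 < f) (hx : 0 < x) (hy : 0 < y) :
    a / y * (1 + v * r) + f / x * (1 + u * r) ≤ 1 - u * v * r ^ 2 ↔
      0 < 1 - u * v * r ^ 2 ∧ f * (1 + u * r) / (1 - u * v * r ^ 2) < x ∧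
        a * x * (1 + v * r) / (x * (1 - u * v * r ^ 2) - f * (1 + u * r)) ≤ y := by
  have h1 : 0 < 1 + v * r := by positivity
  have h2 : 0 < 1 + u * r := by positivity
  set Δ := 1 - u * v * r ^ 2 with hΔ
  have key : a / y * (1 + v * r) + f / x * (1 + u * r) ≤ Δ ↔
      a * x * (1 + v * r) ≤ y * (x * Δ - f * (1 + u * r)) := by
    have : a / y * (1 + v * r) + f / x * (1 + u * r) =
        (a * x * (1 + v * r) + y * (f * (1 + u * r))) / (y * x) := by field_simp
    rw [this, div_le_iff₀ (by positivity)]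
    constructor <;> intro h <;> linarith
  have hpos : 0 < a * x * (1 + v * r) := by positivity
  have hfpos : 0 < f * (1 + u * r) := by positivity
  rw [key]
  constructor
  · intro h
    have h3 : 0 < x * Δ - f * (1 + u * r) := pos_of_mul_pos_right (hpos.trans_le h) hy.le
    have h4 : 0 < Δ := pos_of_mul_pos_right (a := x) (by linarith) hx.le
    exact ⟨h4, by rw [div_lt_iff₀ h4]; linarith, by rwa [div_le_iff₀ h3]⟩
  · rintro ⟨h4, h5, h6⟩
    rw [div_lt_iff₀ h4] at h5
    rwa [div_le_iff₀ (by linarith)] at h6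

/-- Success in terms of the normalized gains `x`, `y` of CD and CU and the squared cosine `r` of
the angle between the two channels. -/
def Feasible (s : System) (x r y : ℝ) : Prop :=
  s.etaV < x ∧ 0 < 1 - s.gammaUreq * s.gammaDreq x * r ^ 2 ∧ s.xi x r < x ∧ s.psi x r ≤ y

theorem mrtSuccess_iff (hs : s.Valid) {V0 : ℝ} {Ω' : Type*} [MeasurableSpace Ω'] {ν : Measure Ω'}
    {ζ : NoiseIdx → Ω' → ℂ} (hζ : IsControlNoise s V0 ν ζ) {M : ℕ}
    {hD hU : EuclideanSpace ℂ (Fin M)} (hD0 : hD ≠ 0) (hU0 : hU ≠ 0) :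
    MRTSuccess s ν ζ hD hU ↔ Feasible s (‖hD‖ ^ 2 / s.betaD)
      (‖inner ℂ hD hU‖ ^ 2 / (‖hD‖ ^ 2 * ‖hU‖ ^ 2)) (‖hU‖ ^ 2 / s.betaU) := by
  have hDn : 0 < ‖hD‖ ^ 2 := by have := norm_pos_iff.2 hD0; positivity
  have hUn : 0 < ‖hU‖ ^ 2 := by have := norm_pos_iff.2 hU0; positivity
  have hβD := hs.hbetaD
  have hβU := hs.hbetaU
  have hP := hs.hPdn
  have hσ := hs.varDn_pos
  have hσU := hs.varUp_pos
  have hgU := hs.gammaUreq_pos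
  set x := ‖hD‖ ^ 2 / s.betaD with hxdef
  set y := ‖hU‖ ^ 2 / s.betaU with hydef
  set r := ‖inner ℂ hD hU‖ ^ 2 / (‖hD‖ ^ 2 * ‖hU‖ ^ 2) with hrdef
  have hx : 0 < x := by positivity
  have hy : 0 < y := by positivity
  have hr : 0 ≤ r := by positivity
  have hxD : ‖hD‖ ^ 2 = s.betaD * x := by rw [hxdef]; field_simp
  have hyU : ‖hU‖ ^ 2 = s.betaU * y := by rw [hydef]; field_simp
  have hS : (1 + snrUp s hD) ^ s.alphaUp = s.Salpha x := by
    rw [snrUp, System.Salpha, System.gbarUp, hxD]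
    congr 2
    ring
  have hsU : ∀ p ∈ Set.Icc 0 s.Pdn, sinr hU (mrtBeam (s.Pdn - p) hU) (mrtBeam p hD) s.varDn =
      (s.Pdn - p) * (s.betaU * y) / (p * (r * (s.betaU * y)) + s.varDn) := fun p hp => by
    rw [sinr, norm_inner_mrtBeam_self (by linarith [hp.2]) hU0, norm_inner_mrtBeam hp.1,
      norm_inner_symm, ← hyU]
    congr 3
    rw [hrdef]
    field_simp
  have hsD : ∀ p ∈ Set.Icc 0 s.Pdn, sinr hD (mrtBeam p hD) (mrtBeam (s.Pdn - p) hU) s.varDn =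
      p * (s.betaD * x) / ((s.Pdn - p) * (r * (s.betaD * x)) + s.varDn) := fun p hp => by
    rw [sinr, norm_inner_mrtBeam_self hp.1 hD0, norm_inner_mrtBeam (by linarith [hp.2]), ← hxD]
    congr 3
    rw [hrdef]
    field_simp
  have step1 : MRTSuccess s ν ζ hD hU ↔ ∃ p ∈ Set.Icc 0 s.Pdn,
      s.gammaUreq ≤ (s.Pdn - p) * (s.betaU * y) / (p * (r * (s.betaU * y)) + s.varDn) ∧
      s.etaV < x ∧
      s.gammaDreq x ≤ p * (s.betaD * x) / ((s.Pdn - p) * (r * (s.betaD * x)) + s.varDn) := by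
    refine exists_congr fun p => and_congr_right fun hp => ?_
    show _ ∧ _ ↔ _
    rw [hS, delay_le_iff hs.hQU hs.hBdn hs.htau (sinr_nonneg _ _ _ hσ.le),
      hs.controlOK_iff_gamma hζ hx.le (sinr_nonneg _ _ _ hσ.le), hsU p hp, hsD p hp]
  rw [step1]
  by_cases hV : s.etaV < x
  swap
  · simp [Feasible, hV]
  have hgD := hs.gammaDreq_pos hV
  have hηf := hs.etaf_pos hV
  have hηU := hs.etaU_pos
  have eU : s.etaU / y = s.gammaUreq * s.varDn / (s.Pdn * (s.betaU * y)) := by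
    rw [System.etaU]; field_simp
  have eD : s.etaf x / x = s.gammaDreq x * s.varDn / (s.Pdn * (s.betaD * x)) := by
    rw [System.etaf, System.gbarD]; field_simp
  unfold Feasible System.xi System.psi
  rw [← feasible_iff hgU.le hgD.le hr hηU hηf hx hy,
    ← exists_split_iff hgU.le hgD.le hr (by positivity) (by positivity)]
  simp only [hV, true_and]
  -- the substitution `p = P_dn d`
  have kU : ∀ d : ℝ, 0 ≤ d → (s.gammaUreq ≤ (s.Pdn - s.Pdn * d) * (s.betaU * y) /
      (s.Pdn * d * (r * (s.betaU * y)) + s.varDn) ↔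
      s.gammaUreq * r * d + s.etaU / y ≤ 1 - d) := fun d hd => by
    rw [le_div_iff₀ (by positivity), eU, ← le_sub_iff_add_le', div_le_iff₀ (by positivity)]
    constructor <;> intro h <;> linarith
  have kD : ∀ d : ℝ, d ≤ 1 → (s.gammaDreq x ≤ s.Pdn * d * (s.betaD * x) /
      ((s.Pdn - s.Pdn * d) * (r * (s.betaD * x)) + s.varDn) ↔
      s.gammaDreq x * r * (1 - d) + s.etaf x / x ≤ d) := fun d hd => by
    have h1 : 0 ≤ s.Pdn - s.Pdn * d := by nlinarith
    rw [le_div_iff₀ (by positivity), eD, ← le_sub_iff_add_le', div_le_iff₀ (by positivity)]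
    constructor <;> intro h <;> linarith
  constructor
  · rintro ⟨p, ⟨hp0, hp1⟩, h1, h2⟩
    obtain ⟨d, rfl⟩ : ∃ d, p = s.Pdn * d := ⟨p / s.Pdn, by field_simp⟩
    have hd0 : 0 ≤ d := nonneg_of_mul_nonneg_right hp0 hP
    have hd1 : d ≤ 1 := by nlinarith
    exact ⟨d, ⟨hd0, hd1⟩, (kU d hd0).1 h1, (kD d hd1).1 h2⟩
  · rintro ⟨d, ⟨hd0, hd1⟩, h1, h2⟩
    exact ⟨s.Pdn * d, ⟨by positivity, by nlinarith⟩, (kU d hd0).2 h1, (kD d hd1).2 h2⟩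

end Deterministic

/-! ### The distribution function of `Gamma(M, 1)` -/

theorem hasDerivAt_erlang_tail (n : ℕ) (t : ℝ) :
    HasDerivAt (fun t : ℝ => -(Real.exp (-t) * ∑ k ∈ Finset.range (n + 1),
      t ^ k / (k.factorial : ℝ))) (fG (n + 1) t) t := by
  have hexp : HasDerivAt (fun t : ℝ => Real.exp (-t)) (-Real.exp (-t)) t := by
    simpa using (hasDerivAt_neg t).exp
  induction n with
  | zero => simpa [fG] using hexp.fun_neg
  | succ n ih =>
    have h := (hexp.mul ((hasDerivAt_pow (n + 1) t).div_const ((n + 1).factorial : ℝ))).neg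
    have h2 := ih.add h
    refine (h2.congr_of_eventuallyEq (Eventually.of_forall fun u => ?_)).congr_deriv ?_
    · simp only [Finset.sum_range_succ _ (n + 1), Pi.add_apply, Pi.neg_apply, Pi.mul_apply]
      ring
    · simp only [fG, Nat.add_sub_cancel, Nat.factorial_succ]
      have : (n.factorial : ℝ) ≠ 0 := by positivity
      have : (n + 1 : ℝ) ≠ 0 := by positivity
      push_cast
      field_simp
      ring

theorem continuous_fG (M : ℕ) : Continuous (fG M) := by unfold fG; fun_prop

theorem FG_eq_integral (n : ℕ) (x : ℝ) : FG (n + 1) x = ∫ t in (0 : ℝ)..x, fG (n + 1) t := by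
  unfold FG fG
  rw [← intervalIntegral.integral_div, Nat.add_sub_cancel, Nat.cast_add, Nat.cast_one,
    Real.Gamma_nat_eq_factorial]

theorem FG_eq (n : ℕ) (x : ℝ) : FG (n + 1) x =
    1 - Real.exp (-x) * ∑ k ∈ Finset.range (n + 1), x ^ k / (k.factorial : ℝ) := by
  rw [FG_eq_integral, intervalIntegral.integral_eq_sub_of_hasDerivAt
    (fun t _ => hasDerivAt_erlang_tail n t) ((continuous_fG _).intervalIntegrable _ _)]
  rw [Finset.sum_range_succ' (fun k => (0 : ℝ) ^ k / (k.factorial : ℝ))]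
  simp
  ring

theorem FG_nonneg (n : ℕ) {x : ℝ} (hx : 0 ≤ x) : 0 ≤ FG (n + 1) x := by
  rw [FG_eq_integral]
  exact intervalIntegral.integral_nonneg hx fun t ht => fG_nonneg _ ht.1

theorem FG_le_one (n : ℕ) {x : ℝ} (hx : 0 ≤ x) : FG (n + 1) x ≤ 1 := by
  rw [FG_eq]
  have : 0 ≤ Real.exp (-x) * ∑ k ∈ Finset.range (n + 1), x ^ k / (k.factorial : ℝ) := by positivity
  linarith

@[fun_prop]
theorem measurable_FG (n : ℕ) : Measurable (FG (n + 1)) := by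
  rw [show FG (n + 1) = _ from funext (FG_eq n)]
  fun_prop

theorem erlang_Ici (n : ℕ) {c : ℝ} (hc : 0 ≤ c) :
    erlang (n + 1) (Set.Ici c) = ENNReal.ofReal (1 - FG (n + 1) c) := by
  have h : erlang (n + 1) (Set.Iio c) = ENNReal.ofReal (FG (n + 1) c) := by
    rw [erlang, withDensity_apply _ measurableSet_Iio, Measure.restrict_restrict measurableSet_Iio,
      Set.Iio_inter_Ioi, ← ofReal_integral_eq_lintegral_ofReal, FG_eq_integral,
      intervalIntegral.integral_of_le hc, integral_Ioc_eq_integral_Ioo]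
    · exact (continuous_fG _).integrableOn_Icc.mono_set Set.Ioo_subset_Icc_self
    · exact (ae_restrict_iff' measurableSet_Ioo).2 (ae_of_all _ fun r hr => fG_nonneg _ hr.1.le)
  rw [← Set.compl_Iio, prob_compl_eq_one_sub measurableSet_Iio, h,
    ENNReal.ofReal_sub _ (FG_nonneg n hc), ENNReal.ofReal_one]

/-! ### The success probability -/

section Assembly

variable {s : System}

@[fun_prop]
theorem measurable_gammaDreq (s : System) : Measurable s.gammaDreq := by
  unfold System.gammaDreq System.Salpha; fun_prop

@[fun_prop]
theorem measurable_etaf (s : System) : Measurable s.etaf := by unfold System.etaf; fun_prop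

@[fun_prop]
theorem measurable_rmax (s : System) : Measurable s.rmax := by unfold System.rmax; fun_prop

@[fun_prop]
theorem measurable_xi (s : System) : Measurable fun z : ℝ × ℝ => s.xi z.1 z.2 := by
  unfold System.xi; fun_prop

@[fun_prop]
theorem measurable_psi (s : System) : Measurable fun z : ℝ × ℝ => s.psi z.1 z.2 := by
  unfold System.psi; fun_prop

theorem measurable_integrand (s : System) (n : ℕ) :
    Measurable fun z : ℝ × ℝ => s.integrand (n + 2) z.1 z.2 := by
  unfold System.integrand
  have h : Measurable fun z : ℝ × ℝ => (if s.xi z.1 z.2 < z.1 then (1 : ℝ) else 0) :=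
    Measurable.ite (measurableSet_lt (by fun_prop) (by fun_prop)) measurable_const measurable_const
  have h2 : Measurable fun z : ℝ × ℝ => FG (n + 2) (s.psi z.1 z.2) :=
    (measurable_FG (n + 1)).comp (measurable_psi s)
  fun_prop

theorem measurableSet_feasible (s : System) :
    MeasurableSet {z : ℝ × ℝ × ℝ | Feasible s z.1 z.2.1 z.2.2} := by
  unfold Feasible
  have hxi : Measurable fun z : ℝ × ℝ × ℝ => s.xi z.1 z.2.1 :=
    (measurable_xi s).comp (f := fun z : ℝ × ℝ × ℝ => (z.1, z.2.1)) (by fun_prop)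
  have hpsi : Measurable fun z : ℝ × ℝ × ℝ => s.psi z.1 z.2.1 :=
    (measurable_psi s).comp (f := fun z : ℝ × ℝ × ℝ => (z.1, z.2.1)) (by fun_prop)
  simp only [Set.ofPred_and]
  refine (measurableSet_lt ?_ ?_).inter ((measurableSet_lt ?_ ?_).inter
    ((measurableSet_lt ?_ ?_).inter (measurableSet_le ?_ ?_))) <;> fun_prop

/-- The open version of the region of integration; it differs from the closed one by a null set,
on which `ξ` and `ψ` may take junk values. -/
def openRegion (s : System) : Set (ℝ × ℝ) := {z | s.etaV < z.1 ∧ 0 < z.2 ∧ z.2 < s.rmax z.1}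

theorem measurableSet_openRegion (s : System) : MeasurableSet (openRegion s) := by
  simp only [openRegion, Set.ofPred_and]
  refine (measurableSet_lt ?_ ?_).inter ((measurableSet_lt ?_ ?_).inter
    (measurableSet_lt ?_ ?_)) <;> fun_prop

theorem closedRegion_ae_eq (s : System) :
    {z : ℝ × ℝ | s.etaV < z.1 ∧ 0 ≤ z.2 ∧ z.2 ≤ s.rmax z.1} =ᵐ[volume] openRegion s := by
  have hgraph : ∀ f : ℝ → ℝ, Measurable f → ∀ᵐ z : ℝ × ℝ, z.2 ≠ f z.1 := fun f hf => by
    have hm : MeasurableSet {z : ℝ × ℝ | z.2 = f z.1} :=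
      measurableSet_eq_fun (by fun_prop) (by fun_prop)
    rw [ae_iff]
    simp only [ne_eq, not_not]
    rw [Measure.volume_eq_prod, Measure.measure_prod_null hm]
    refine ae_of_all _ fun x => ?_
    show volume {r : ℝ | r = f x} = 0
    simp
  filter_upwards [hgraph (fun _ => 0) measurable_const, hgraph s.rmax (measurable_rmax s)]
    with z h0 h1
  refine propext ⟨fun h => ⟨h.1, ?_, ?_⟩, fun h => ⟨h.1, h.2.1.le, h.2.2.le⟩⟩
  · exact lt_of_le_of_ne h.2.1 (Ne.symm h0)
  · exact lt_of_le_of_ne h.2.2 h1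

theorem lt_rmax_iff (hs : s.Valid) {x r : ℝ} (hx : s.etaV < x) (hr : 0 < r) :
    r < s.rmax x ↔ r < 1 ∧ 0 < 1 - s.gammaUreq * s.gammaDreq x * r ^ 2 := by
  have hc : 0 < s.gammaUreq * s.gammaDreq x := mul_pos hs.gammaUreq_pos (hs.gammaDreq_pos hx)
  rw [System.rmax, lt_min_iff, lt_div_iff₀ (Real.sqrt_pos.2 hc), sub_pos]
  refine and_congr_right fun _ => ?_
  rw [← sq_lt_one_iff₀ (by positivity), mul_pow, Real.sq_sqrt hc.le, mul_comm]

theorem psi_nonneg (hs : s.Valid) {x r : ℝ} (hx : s.etaV < x) (hr : 0 ≤ r)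
    (hΔ : 0 < 1 - s.gammaUreq * s.gammaDreq x * r ^ 2) (hxi : s.xi x r < x) :
    0 ≤ s.psi x r := by
  have hx0 := hs.etaV_pos.trans hx
  have h1 := hs.etaU_pos
  have h2 := hs.gammaDreq_pos hx
  rw [System.xi, div_lt_iff₀ hΔ] at hxi
  exact div_nonneg (by positivity) (by linarith)

theorem fRho_nonneg (n : ℕ) {r : ℝ} (hr : r ≤ 1) : 0 ≤ fRho (n + 2) r := by
  have h : (0 : ℝ) ≤ 1 - r := by linarith
  have hn : (0 : ℝ) ≤ n := n.cast_nonneg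
  unfold fRho
  push_cast
  exact mul_nonneg (by linarith) (by positivity)

/-- On the open region `ψ ≥ 0` wherever the indicator is `1`, so that `1 - F_G(ψ) ≥ 0`. -/
theorem integrand_nonneg (hs : s.Valid) (n : ℕ) {z : ℝ × ℝ} (hz : z ∈ openRegion s) :
    0 ≤ s.integrand (n + 2) z.1 z.2 := by
  obtain ⟨h1, h2, h3⟩ := hz
  obtain ⟨h4, h5⟩ := (lt_rmax_iff hs h1 h2).1 h3
  unfold System.integrand
  split_ifs with h
  · have := FG_le_one (n + 1) (psi_nonneg hs h1 h2.le h5 h)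
    have h6 := fG_nonneg (n + 2) (hs.etaV_pos.trans h1).le
    have h7 := fRho_nonneg n h4.le
    rw [mul_one]
    exact mul_nonneg (mul_nonneg h6 h7) (by linarith)
  · simp

/-- The conditional success probability given `x` and `r`. -/
theorem lintegral_feasible (hs : s.Valid) (n : ℕ) {x r : ℝ} (hx : s.etaV < x) (hr : 0 < r)
    (hr1 : r < 1) :
    ENNReal.ofReal (fG (n + 2) x) * (ENNReal.ofReal (fRho (n + 2) r) *
      erlang (n + 2) {y | Feasible s x r y}) =
      (openRegion s).indicator (fun z => ENNReal.ofReal (s.integrand (n + 2) z.1 z.2)) (x, r) := by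
  have hrm := lt_rmax_iff hs hx hr
  by_cases hΔ : 0 < 1 - s.gammaUreq * s.gammaDreq x * r ^ 2
  swap
  · rw [Set.indicator_of_notMem fun h => hΔ (hrm.1 h.2.2).2]
    simp [Feasible, hΔ]
  rw [Set.indicator_of_mem (show (x, r) ∈ openRegion s from ⟨hx, hr, hrm.2 ⟨hr1, hΔ⟩⟩)]
  unfold System.integrand
  by_cases hxi : s.xi x r < x
  · have : {y | Feasible s x r y} = Set.Ici (s.psi x r) := by
      ext y; simp [Feasible, hx, hΔ, hxi]
    rw [this, erlang_Ici (n + 1) (psi_nonneg hs hx hr.le hΔ hxi)]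
    simp only [hxi, if_true, mul_one]
    rw [ENNReal.ofReal_mul (mul_nonneg (fG_nonneg _ (hs.etaV_pos.trans hx).le)
      (fRho_nonneg n hr1.le)), ENNReal.ofReal_mul (fG_nonneg _ (hs.etaV_pos.trans hx).le), mul_assoc]
  · simp [Feasible, hxi]

theorem ae_ne_zero_complexGaussianVector (n : ℕ) {v : ℝ} (hv : 0 < v) :
    ∀ᵐ h ∂complexGaussianVector (n + 1) v, h ≠ 0 := by
  have h := lintegral_complexGaussianVector_norm hv n
    (G := Set.indicator {0} 1) (measurable_one.indicator (measurableSet_singleton 0))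
  have h0 : erlang (n + 1) {0} = 0 := by
    refine (withDensity_absolutelyContinuous _ _) ?_
    simp
  rw [lintegral_indicator_one (measurableSet_singleton 0), h0] at h
  have hm : Measurable fun h : EuclideanSpace ℂ (Fin (n + 1)) =>
      (Set.indicator {0} 1 (‖h‖ ^ 2 / v) : ℝ≥0∞) :=
    (measurable_one.indicator (measurableSet_singleton 0)).comp (by fun_prop)
  rw [lintegral_eq_zero_iff hm] at h
  filter_upwards [h] with g hg hg0
  subst hg0
  simp at hg

/-- The pairs of channels that allow success, expressed through gains and angle. -/
def feasibleChannels (s : System) (M : ℕ) :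
    Set (EuclideanSpace ℂ (Fin M) × EuclideanSpace ℂ (Fin M)) :=
  {p | Feasible s (‖p.1‖ ^ 2 / s.betaD)
    (‖inner ℂ p.1 p.2‖ ^ 2 / (‖p.1‖ ^ 2 * ‖p.2‖ ^ 2)) (‖p.2‖ ^ 2 / s.betaU)}

theorem measurableSet_feasibleChannels (s : System) (M : ℕ) :
    MeasurableSet (feasibleChannels s M) :=
  (measurableSet_feasible s).preimage (f := fun p : EuclideanSpace ℂ (Fin M) ×
    EuclideanSpace ℂ (Fin M) => (‖p.1‖ ^ 2 / s.betaD,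
      ‖inner ℂ p.1 p.2‖ ^ 2 / (‖p.1‖ ^ 2 * ‖p.2‖ ^ 2), ‖p.2‖ ^ 2 / s.betaU)) (by fun_prop)

/-- The success probability as an integral: condition on `h_D`, use that the angle is
`Beta(1, M - 1)` and independent of the two gains, and integrate out the gain of CU. -/
theorem measure_feasibleChannels (hs : s.Valid) (n : ℕ) :
    ((complexGaussianVector (n + 2) s.betaD).prod (complexGaussianVector (n + 2) s.betaU))
      (feasibleChannels s (n + 2)) =
      ∫⁻ z in openRegion s, ENNReal.ofReal (s.integrand (n + 2) z.1 z.2) := by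
  set Φ : ℝ × ℝ × ℝ → ℝ≥0∞ := Set.indicator {z | Feasible s z.1 z.2.1 z.2.2} 1 with hΦ
  have hΦm : Measurable Φ := measurable_one.indicator (measurableSet_feasible s)
  have hsec : ∀ x r, ∫⁻ y, Φ (x, r, y) ∂erlang (n + 2) =
      erlang (n + 2) {y | Feasible s x r y} := fun x r =>
    lintegral_indicator_one ((measurableSet_feasible s).preimage
      (f := fun y : ℝ => (x, r, y)) (by fun_prop))
  -- integrate over `h_U` for fixed `h_D`
  have h1 : ∀ h : EuclideanSpace ℂ (Fin (n + 2)), h ≠ 0 →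
      complexGaussianVector (n + 2) s.betaU (Prod.mk h ⁻¹' feasibleChannels s (n + 2)) =
      ∫⁻ r in Set.Ioo 0 1, ENNReal.ofReal (fRho (n + 2) r) *
        erlang (n + 2) {y | Feasible s (‖h‖ ^ 2 / s.betaD) r y} := fun h hh => by
    have hm : Measurable fun p : ℝ × ℝ => Φ (‖h‖ ^ 2 / s.betaD, p.1, p.2) := by fun_prop
    have := lintegral_complexGaussianVector_angle hs.hbetaU n hh
      (F := fun r y => Φ (‖h‖ ^ 2 / s.betaD, r, y)) hm
    rw [← lintegral_indicator_one ((measurableSet_feasibleChannels s _).preimage (by fun_prop))]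
    refine this.trans ?_
    rw [lintegral_lintegral_swap (by unfold Function.uncurry; fun_prop)]
    refine lintegral_congr fun r => ?_
    rw [lintegral_const_mul _ (by fun_prop), hsec]
  have hErl : Measurable fun z : ℝ × ℝ => erlang (n + 2) {y | Feasible s z.1 z.2 y} := by
    simp only [← hsec]
    exact Measurable.lintegral_prod_right'
      (f := fun q : (ℝ × ℝ) × ℝ => Φ (q.1.1, q.1.2, q.2)) (by fun_prop)
  have hJ : Measurable fun x => ∫⁻ r in Set.Ioo (0 : ℝ) 1, ENNReal.ofReal (fRho (n + 2) r) *
      erlang (n + 2) {y | Feasible s x r y} :=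
    Measurable.lintegral_prod_right' (ν := volume.restrict (Set.Ioo (0 : ℝ) 1))
      (f := fun q : ℝ × ℝ => ENNReal.ofReal (fRho (n + 2) q.2) *
      erlang (n + 2) {y | Feasible s q.1 q.2 y}) (Measurable.mul (by fun_prop) hErl)
  rw [Measure.prod_apply (measurableSet_feasibleChannels s _),
    lintegral_congr_ae ((ae_ne_zero_complexGaussianVector (n + 1) hs.hbetaD).mono h1),
    lintegral_complexGaussianVector_norm hs.hbetaD (n + 1) hJ, lintegral_erlang _ hJ,
    ← lintegral_indicator (measurableSet_openRegion s), Measure.volume_eq_prod,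
    lintegral_prod _ ((measurable_integrand s n).ennreal_ofReal.indicator
      (measurableSet_openRegion s)).aemeasurable, ← lintegral_indicator measurableSet_Ioi]
  refine lintegral_congr fun x => ?_
  by_cases hx : s.etaV < x
  · rw [Set.indicator_of_mem (Set.mem_Ioi.2 (hs.etaV_pos.trans hx)),
      ← lintegral_const_mul' _ _ ENNReal.ofReal_ne_top, ← lintegral_indicator measurableSet_Ioo]
    refine lintegral_congr fun r => ?_
    by_cases hr : r ∈ Set.Ioo (0 : ℝ) 1
    · rw [Set.indicator_of_mem hr, ← lintegral_feasible hs n hx hr.1 hr.2]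
    · rw [Set.indicator_of_notMem hr, Set.indicator_of_notMem]
      exact fun h => hr ⟨h.2.1, ((lt_rmax_iff hs hx h.2.1).1 h.2.2).1⟩
  · have hz : ∀ r, (openRegion s).indicator
        (fun z => ENNReal.ofReal (s.integrand (n + 2) z.1 z.2)) (x, r) = 0 := fun r =>
      Set.indicator_of_notMem (fun h => hx h.1) _
    simp only [hz, lintegral_zero]
    by_cases hx0 : 0 < x
    · rw [Set.indicator_of_mem (Set.mem_Ioi.2 hx0)]
      simp [Feasible, hx]
    · exact Set.indicator_of_notMem hx0 _

/-- The integral of the nonnegative integrand is a probability, hence finite. -/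
theorem integrableOn_integrand (hs : s.Valid) (n : ℕ) :
    IntegrableOn (fun z : ℝ × ℝ => s.integrand (n + 2) z.1 z.2) (openRegion s) := by
  refine ⟨(measurable_integrand s n).aestronglyMeasurable, ?_⟩
  rw [hasFiniteIntegral_iff_ofReal ((ae_restrict_iff' (measurableSet_openRegion s)).2
    (ae_of_all _ fun z hz => integrand_nonneg hs n hz)), ← measure_feasibleChannels hs n]
  exact measure_lt_top _ _

theorem setIntegral_integrand (hs : s.Valid) (n : ℕ) :
    ∫ z in openRegion s, s.integrand (n + 2) z.1 z.2 =
      ∫ x in Set.Ioi s.etaV, ∫ r in Set.Icc 0 (s.rmax x), s.integrand (n + 2) x r := by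
  rw [← integral_indicator (measurableSet_openRegion s), Measure.volume_eq_prod, integral_prod,
    ← integral_indicator measurableSet_Ioi]
  · refine integral_congr_ae (ae_of_all _ fun x => ?_)
    simp only
    by_cases hx : s.etaV < x
    · rw [Set.indicator_of_mem (Set.mem_Ioi.2 hx), integral_Icc_eq_integral_Ioo,
        ← integral_indicator measurableSet_Ioo]
      refine integral_congr_ae (ae_of_all _ fun r => ?_)
      simp [Set.indicator, openRegion, hx]
    · rw [Set.indicator_of_notMem (by simpa using hx)]
      refine integral_eq_zero_of_ae (ae_of_all _ fun r => ?_)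
      exact Set.indicator_of_notMem (fun h => hx h.1) _
  · exact (integrable_indicator_iff (measurableSet_openRegion s)).2 (integrableOn_integrand hs n)

end Assembly

end JDCC

theorem theorem6 (s : JDCC.System) (M : ℕ) (hM : 2 ≤ M)
    (ha : 1 < ‖s.a‖) (hb : s.b ≠ 0) (hW : 0 < s.varW)
    (hPup : 0 < s.Pup) (hPdn : 0 < s.Pdn) (hBup : 0 < s.Bup) (hBdn : 0 < s.Bdn)
    (hTs : 0 < s.Ts) (hN0 : 0 < s.N0) (hbetaD : 0 < s.betaD) (hbetaU : 0 < s.betaU)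
    (hQU : 0 < s.QU) (htau : 0 < s.tauReq) (hVreq : s.varW < s.Vreq)
    -- the control loop
    (V0 : ℝ) (hV0 : 0 ≤ V0)
    {Ω' : Type*} [MeasurableSpace Ω'] (ν : Measure Ω') [IsProbabilityMeasure ν]
    (ζ : JDCC.NoiseIdx → Ω' → ℂ) (hζ : JDCC.IsControlNoise s V0 ν ζ)
    -- the channels: independent Rayleigh fading
    {Ω : Type*} [MeasurableSpace Ω] (P : Measure Ω) [IsProbabilityMeasure P]
    (hD hU : Ω → EuclideanSpace ℂ (Fin M))
    (hDlaw : HasLaw hD (JDCC.complexGaussianVector M s.betaD) P)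
    (hUlaw : HasLaw hU (JDCC.complexGaussianVector M s.betaU) P)
    (hindep : IndepFun hD hU P) :
    -- the closed form of the distribution function of `Gamma(M, 1)`
    (∀ x : ℝ, 0 ≤ x → JDCC.FG M x =
      1 - Real.exp (-x) * ∑ k ∈ Finset.range M, x ^ k / (k.factorial : ℝ)) ∧
    -- the double integral converges absolutely
    IntegrableOn (fun z : ℝ × ℝ => s.integrand M z.1 z.2)
      {z : ℝ × ℝ | s.etaV < z.1 ∧ 0 ≤ z.2 ∧ z.2 ≤ s.rmax z.1} ∧
    -- the outage probability
    JDCC.outageMRT s ν ζ P hD hU =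
      1 - ∫ x in Set.Ioi s.etaV, ∫ r in Set.Icc 0 (s.rmax x), s.integrand M x r := by
  have hs : s.Valid := ⟨ha, hb, hW, hPup, hPdn, hBup, hBdn, hTs, hN0, hbetaD, hbetaU, hQU, htau,
    hVreq⟩
  obtain ⟨n, rfl⟩ : ∃ n, M = n + 2 := ⟨M - 2, by omega⟩
  refine ⟨fun x _ => JDCC.FG_eq (n + 1) x, ?_, ?_⟩
  · exact (JDCC.integrableOn_integrand hs n).congr_set_ae (JDCC.closedRegion_ae_eq s)
  · have hlaw := (indepFun_iff_hasLaw_prodMk_prod hDlaw hUlaw).1 hindep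
    have hD0 : ∀ᵐ ω ∂P, hD ω ≠ 0 :=
      ae_of_ae_map hDlaw.aemeasurable (by
        rw [hDlaw.map_eq]; exact JDCC.ae_ne_zero_complexGaussianVector (n + 1) hbetaD)
    have hU0 : ∀ᵐ ω ∂P, hU ω ≠ 0 :=
      ae_of_ae_map hUlaw.aemeasurable (by
        rw [hUlaw.map_eq]; exact JDCC.ae_ne_zero_complexGaussianVector (n + 1) hbetaU)
    have hset : {ω | JDCC.MRTSuccess s ν ζ (hD ω) (hU ω)} =ᵐ[P]
        {ω | (hD ω, hU ω) ∈ JDCC.feasibleChannels s (n + 2)} := by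
      filter_upwards [hD0, hU0] with ω h1 h2
      exact propext (JDCC.mrtSuccess_iff hs hζ h1 h2)
    rw [JDCC.outageMRT, measureReal_congr hset,
      hlaw.measureReal_eq (p := fun q => q ∈ JDCC.feasibleChannels s (n + 2))
        (JDCC.measurableSet_feasibleChannels s (n + 2)),
      ← JDCC.setIntegral_integrand hs n, integral_eq_lintegral_of_nonneg_ae]
    · rw [← JDCC.measure_feasibleChannels hs n]
      rfl
    · exact (ae_restrict_iff' (JDCC.measurableSet_openRegion s)).2
        (ae_of_all _ fun z hz => JDCC.integrand_nonneg hs n hz)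
    · exact (JDCC.measurable_integrand s n).aestronglyMeasurable
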